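/- Let $\mathcal H$ be a separable complex Hilbert space, $H_0$ a (possibly unbounded) self-adjoint operator on $\mathcal H$ with compact resolvent, $P$ an orthogonal projection on $\mathcal H$, and $H_v=H_0+vP$ for $v\in\mathbb R$. For an interval $I\subset\mathbb R$ let $P_I(H_v)$ be the spectral projection of $H_v$ onto $I$ (the orthogonal projection onto the closed span of the eigenspaces with eigenvalues in $I$), write $P_{\{E\}}(H_v)$ for the projection onto the eigenspace of $E$, and set $$Q_v(\phi,\psi;I)=\sum_{E\in\sigma(H_v)\cap I}\bigl|\langle\phi,P_{\{E\}}(H_v)\psi\rangle\bigr| .$$ Let $0<s<1$, let $I\subset\mathbb R$ be an interval, let $\phi\in\operatorname{ran}P$ with $\|\phi\|=1$, let $\psi\in\mathcal H$ and $v\in\mathbb R$, and let $(\phi_n)_{n}$ be any orthonormal basis of $\operatorname{ran}P$ (of finite or infinite dimension). Then $u\mapsto Q_{u+v}(\phi,\psi;I)$ and $u\mapsto\|P_I(H_{u+v})\psi\|$ are Lebesgue measurable and $$\int_{\mathbb R}\frac{Q_{u+v}(\phi,\psi;I)^{2-s}}{\|P_I(H_{u+v})\psi\|^{2-2s}}\,\frac{du}{|u|^s}\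 \le\ \sum_{n}\int_I\bigl|\langle\phi_n,(H_v-E)^{-1}\psi\rangle\bigr|^s\,dE ,$$ where the quotient is read as $0$ when $\|P_I(H_{u+v})\psi\|=0$ (in which case $Q_{u+v}(\phi,\psi;I)=0$). In particular, $$\int_{\mathbb R}Q_{u+v}(\phi,\psi;I)^{2-s}\,\frac{du}{|u|^s}\ \le\ \Bigl(\sup_{u\in\mathbb R}\|P_I(H_{u+v})\psi\|\Bigr)^{2-2s}\sum_{n}\int_I\bigl|\langle\phi_n,(H_v-E)^{-1}\psi\rangle\bigr|^s\,dE .$$ Both sides take values in $[0,\infty]$, with the convention $0\cdot\infty=0$. -/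

import Mathlib

open MeasureTheory
open scoped ENNReal

noncomputable section

namespace AveragingBound

variable {H : Type*} [NormedAddCommGroup H] [InnerProductSpace ℂ H]

/-- `R` is a bounded two-sided inverse of `T - z`, where `T` is an operator defined on the
subspace `T.domain` of `H`. -/
def IsResolventAt (T : H →ₗ.[ℂ] H) (z : ℂ) (R : H →L[ℂ] H) : Prop :=
  (∀ y : H, ∃ h : R y ∈ T.domain, T ⟨R y, h⟩ - z • R y = y) ∧
    ∀ x : T.domain, R (T x - z • (x : H)) = x

/-- The resolvent set of a (possibly unbounded) operator. -/
def resolventSet (T : H →ₗ.[ℂ] H) : Set ℂ :=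
  {z | ∃ R : H →L[ℂ] H, IsResolventAt T z R}

/-- The spectrum of a (possibly unbounded) operator. -/
def spectrum (T : H →ₗ.[ℂ] H) : Set ℂ :=
  (resolventSet T)ᶜ

open Classical in
/-- The resolvent `(T - z)⁻¹`, with the value `0` for `z` in the spectrum of `T`. -/
def resolvent (T : H →ₗ.[ℂ] H) (z : ℂ) : H →L[ℂ] H :=
  if h : ∃ R : H →L[ℂ] H, IsResolventAt T z R then h.choose else 0

/-- `T` has compact resolvent: `(T - z)⁻¹` is compact for some `z` in the resolvent set. -/
def HasCompactResolvent (T : H →ₗ.[ℂ] H) : Prop :=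
  ∃ z ∈ resolventSet T, IsCompactOperator (resolvent T z)

/-- The eigenspace `{x ∈ D(T) | T x = E x}`. -/
def eigenspace (T : H →ₗ.[ℂ] H) (E : ℝ) : Submodule ℂ H :=
  (LinearMap.ker (T.toFun - (E : ℂ) • T.domain.subtype)).map T.domain.subtype

/-- The spectral projection `P_I(T)` of a self-adjoint operator `T` with pure point spectrum: the
orthogonal projection onto the closed linear span of the eigenspaces of `T` whose eigenvalues lie
in `I`.  For `I = {E}` it is the orthogonal projection onto the eigenspace. -/
def spectralProj [CompleteSpace H] (T : H →ₗ.[ℂ] H) (I : Set ℝ) : H →L[ℂ] H :=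
  (⨆ E ∈ I, eigenspace T E).topologicalClosure.starProjection

/-- The eigenfunction correlator
`Q(φ, ψ; I) = ∑_{E ∈ σ(T) ∩ I} |⟨φ, P_{E}(T) ψ⟩|`, a sum of nonnegative terms. -/
def correlator [CompleteSpace H] (T : H →ₗ.[ℂ] H) (φ ψ : H) (I : Set ℝ) : ℝ≥0∞ :=
  ∑' E : {E : ℝ // (E : ℂ) ∈ spectrum T ∧ E ∈ I}, ‖inner ℂ φ (spectralProj T {E.1} ψ)‖ₑ

/-- The operator `H_v = H₀ + v P`, with the domain of `H₀`. -/
def perturbed (H₀ : H →ₗ.[ℂ] H) (P : H →L[ℂ] H) (v : ℝ) : H →ₗ.[ℂ] H :=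
  ((v : ℂ) • (P : H →ₗ[ℂ] H)) +ᵥ H₀

end AveragingBound

end

/-!
Write `A = H_v` and `A_u = A + u P`. Two facts about these operators carry the proof.

*Spectral averaging* (`bind_specMeasure_le_volume`, `lintegral_tsum_le`). For `φ` in the unit ball
of `ran P`, the spectral measures of `φ` with respect to `A_u`, integrated over `u`, are dominated
by Lebesgue measure. For `Im z > 0` the function `w ↦ ⟨φ, (A + w P - z)⁻¹ φ⟩` is holomorphic with
nonnegative imaginary part on `Im w ≤ 0`, because `A + w P - z` is strictly dissipative there, and
its imaginary part at `w = -i R` is at most `1 / R`. The Poisson formula, obtained from the mean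
value property by a Cayley transform, then bounds the integral of its imaginary part over real `w`
by `π`. By the eigenfunction expansion this imaginary part is the Poisson integral of the spectral
measure, so letting `Im z → 0` gives the claim. Approximation by simple functions extends it to
vectors that depend measurably on the energy.

*The Birman–Schwinger identity* (`norm_spectralProj_perturbed_le`). If `A_u Ψ = E Ψ` and `E` is
not in the spectrum of `A`, then `Ψ = -u (A - E)⁻¹ P Ψ`. Hence the eigenprojection `P_E` of `A_u`
satisfies `‖P_E ψ‖ ≤ |u| N(E) ‖P_E e(E)‖`, where `N(E) = ‖P (A - E)⁻¹ ψ‖` and `e(E)` is the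
normalised vector `P (A - E)⁻¹ ψ`. The spectrum of `A` is countable, so by spectral averaging it
carries no mass of `φ` for almost every `u`.

The correlator is at most `∑_{E ∈ I} ‖P_E φ‖ ‖P_E ψ‖`. By Hölder's inequality its power `2 - s` is
at most `‖P_I ψ‖ ^ (2 - 2 s)` times `∑ ‖P_E ψ‖ ^ s ‖P_E φ‖ ^ (2 - s)`. The Birman–Schwinger bound
followed by the inequality of arithmetic and geometric means replaces each term by `|u| ^ s N(E) ^
s ((s / 2) ‖P_E e(E)‖ ^ 2 + (1 - s / 2) ‖P_E φ‖ ^ 2)`, which is quadratic in the projections.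
Dividing by `|u| ^ s` and averaging over `u` leaves `∫_I N(E) ^ s dE`, and Parseval's identity in
`ran P` with `s ≤ 2` bounds `N(E) ^ s` by the sum over the orthonormal basis.

Spectral projections of `A_u` depend measurably on `u` because they are limits of polynomials in
the resolvents at nonreal points, which are norm-continuous in `u`.
-/

namespace AveragingBound

variable {H : Type*} [NormedAddCommGroup H] [InnerProductSpace ℂ H]

/-! ### Resolvents of perturbed operators -/

theorem isFormalAdjoint_self_of_isSelfAdjoint [CompleteSpace H] {T : H →ₗ.[ℂ] H}
    (hT : IsSelfAdjoint T) : T.IsFormalAdjoint T := by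
  have h := LinearPMap.adjoint_isFormalAdjoint (T := T) hT.dense_domain
  rwa [LinearPMap.isSelfAdjoint_def.mp hT] at h

theorem IsResolventAt.unique {T : H →ₗ.[ℂ] H} {z : ℂ} {R R' : H →L[ℂ] H}
    (h : IsResolventAt T z R) (h' : IsResolventAt T z R') : R = R' := by
  ext y
  obtain ⟨hy, e⟩ := h'.1 y
  have := h.2 ⟨R' y, hy⟩
  rwa [e] at this

theorem IsResolventAt.resolvent_eq {T : H →ₗ.[ℂ] H} {z : ℂ} {R : H →L[ℂ] H}
    (h : IsResolventAt T z R) : resolvent T z = R := by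
  have hex : ∃ R : H →L[ℂ] H, IsResolventAt T z R := ⟨R, h⟩
  rw [resolvent, dif_pos hex]
  exact hex.choose_spec.unique h

theorem isResolventAt_resolvent {T : H →ₗ.[ℂ] H} {z : ℂ} (h : z ∈ resolventSet T) :
    IsResolventAt T z (resolvent T z) := by
  obtain ⟨R, hR⟩ := h
  rwa [hR.resolvent_eq]

theorem IsResolventAt.eq_zero_of_apply_eq {T : H →ₗ.[ℂ] H} {z : ℂ} {R : H →L[ℂ] H}
    (h : IsResolventAt T z R) {x : T.domain} (hx : T x = z • (x : H)) : (x : H) = 0 := by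
  rw [← h.2 x, hx, sub_self, map_zero]

/-- By the Fredholm alternative, a number `z` that is not an eigenvalue of `T + B`, where `B` is
bounded and `T` has the compact resolvent `K` at `z₀`, lies in the resolvent set of `T + B`, and the
resolvent is `K (1 + (B - (z - z₀)) K)⁻¹`. -/
theorem IsResolventAt.vadd [CompleteSpace H] {T : H →ₗ.[ℂ] H} {z₀ : ℂ} {K : H →L[ℂ] H}
    (hK : IsResolventAt T z₀ K) (hKc : IsCompactOperator K) (B : H →L[ℂ] H) (z : ℂ)
    (hinj : ∀ x : T.domain, B x + T x = z • (x : H) → (x : H) = 0) :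
    IsUnit (1 + (B - (z - z₀) • 1) * K) ∧
      IsResolventAt ((B : H →ₗ[ℂ] H) +ᵥ T) z
        (K * Ring.inverse (1 + (B - (z - z₀) • 1) * K)) := by
  set C : H →L[ℂ] H := (B - (z - z₀) • 1) * K with hC
  have hCx (x : H) : C x = B (K x) - (z - z₀) • K x := by simp [hC]
  have hunit : IsUnit (1 + C) := by
    have hCc : IsCompactOperator (C : H → H) := by
      convert! hKc.clm_comp (B - (z - z₀) • 1)
    rcases hCc.hasEigenvalue_or_mem_resolventSet (μ := (-1 : ℂ)) (by simp) with h | h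
    · exfalso
      obtain ⟨x, hx, hx0⟩ := h.exists_hasEigenvector
      have hx : C x = (-1 : ℂ) • x := Module.End.mem_eigenspace_iff.mp hx
      obtain ⟨hd, he⟩ := hK.1 x
      have hy : K x = 0 := by
        refine hinj ⟨K x, hd⟩ ?_
        have h3 := hCx x
        rw [hx] at h3
        have : T ⟨K x, hd⟩ = x + z₀ • K x := eq_add_of_sub_eq he
        simp only [this]
        linear_combination (norm := module) -h3
      apply hx0
      have h3 := hCx x
      rw [hx, hy] at h3
      simpa using h3
    · rw [_root_.spectrum.mem_resolventSet_iff] at h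
      have := h.neg
      simpa [add_comm] using this
  refine ⟨hunit, ?_⟩
  set W := Ring.inverse (1 + C) with hW
  have h1 : (1 + C) * W = 1 := Ring.mul_inverse_cancel _ hunit
  have h2 : W * (1 + C) = 1 := Ring.inverse_mul_cancel _ hunit
  constructor
  · intro y
    obtain ⟨hd, he⟩ := hK.1 (W y)
    refine ⟨hd, ?_⟩
    have h3 : W y + C (W y) = y := by simpa using DFunLike.congr_fun h1 y
    rw [LinearPMap.vadd_apply]
    change B (K (W y)) + T ⟨K (W y), hd⟩ - z • K (W y) = y
    rw [hCx] at h3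
    linear_combination (norm := module) h3 + he
  · intro x
    have h3 := hK.2 x
    rw [LinearPMap.vadd_apply]
    change K (W (B x + T x - z • (x : H))) = x
    have h4 : B x + T x - z • (x : H) = (1 + C) (T x - z₀ • (x : H)) := by
      rw [add_apply, hCx, h3]
      simp only [one_apply_eq_self]
      module
    rw [h4]
    have := DFunLike.congr_fun h2 (T x - z₀ • (x : H))
    simp only [mul_apply_eq_comp, one_apply_eq_self] at this
    rw [this, h3]

theorem inner_apply_self_im {T : H →ₗ.[ℂ] H} (hT : T.IsFormalAdjoint T) (x : T.domain) :
    (inner ℂ (x : H) (T x)).im = 0 := by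
  have h := hT x x
  rw [← inner_conj_symm] at h
  exact Complex.conj_eq_iff_im.mp h

/-- If `(T - z) x = y` with `T` symmetric, then `Im ⟨y, x⟩ = Im z ‖x‖²`. -/
theorem inner_im_of_apply_sub_smul {T : H →ₗ.[ℂ] H} (hT : T.IsFormalAdjoint T) (x : T.domain)
    {y : H} {z : ℂ} (h : T x - z • (x : H) = y) :
    (inner ℂ y (x : H)).im = z.im * ‖(x : H)‖ ^ 2 := by
  rw [← inner_conj_symm, Complex.conj_im, ← h, inner_sub_right, inner_smul_right,
    inner_self_eq_norm_sq_to_K, Complex.sub_im, inner_apply_self_im hT x]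
  simp [← Complex.ofReal_pow]

theorem eq_zero_of_im_ne_zero {T : H →ₗ.[ℂ] H} (hT : T.IsFormalAdjoint T) {z : ℂ} (hz : z.im ≠ 0)
    (x : T.domain) (h : T x = z • (x : H)) : (x : H) = 0 := by
  have := inner_im_of_apply_sub_smul hT x (y := 0) (z := z) (by rw [h, sub_self])
  simpa [hz] using this

theorem HasCompactResolvent.exists_isResolventAt [CompleteSpace H] {T : H →ₗ.[ℂ] H}
    (hc : HasCompactResolvent T) {z : ℂ}
    (hz : ∀ x : T.domain, T x = z • (x : H) → (x : H) = 0) :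
    ∃ R : H →L[ℂ] H, IsResolventAt T z R ∧ IsCompactOperator R := by
  obtain ⟨z₀, h₀, hK⟩ := hc
  have h := (isResolventAt_resolvent h₀).vadd hK 0 z (fun x hx ↦ hz x (by simpa using hx))
  rw [show ((0 : H →L[ℂ] H) : H →ₗ[ℂ] H) +ᵥ T = T by simp] at h
  exact ⟨_, h.2, by convert! hK.comp_clm _⟩

theorem mem_resolventSet_of_im_ne_zero [CompleteSpace H] {T : H →ₗ.[ℂ] H}
    (hT : T.IsFormalAdjoint T) (hc : HasCompactResolvent T) {z : ℂ} (hz : z.im ≠ 0) :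
    z ∈ resolventSet T :=
  (hc.exists_isResolventAt (eq_zero_of_im_ne_zero hT hz)).imp fun _ h ↦ h.1

theorem HasCompactResolvent.isCompactOperator_resolvent [CompleteSpace H] {T : H →ₗ.[ℂ] H}
    (hc : HasCompactResolvent T) {z : ℂ} (hz : z ∈ resolventSet T) :
    IsCompactOperator (resolvent T z) := by
  obtain ⟨R, hR, hRc⟩ := hc.exists_isResolventAt
    (fun x ↦ (isResolventAt_resolvent hz).eq_zero_of_apply_eq (x := x))
  rwa [hR.resolvent_eq]

/-- The first resolvent identity, solved for the resolvent at `z`. -/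
theorem resolvent_eq_mul_inverse [CompleteSpace H] {T : H →ₗ.[ℂ] H}
    (hc : HasCompactResolvent T) {z₀ z : ℂ} (hz₀ : z₀ ∈ resolventSet T)
    (hz : z ∈ resolventSet T) :
    IsUnit (1 + (-(z - z₀)) • resolvent T z₀) ∧
      resolvent T z = resolvent T z₀ * Ring.inverse (1 + (-(z - z₀)) • resolvent T z₀) := by
  have h := (isResolventAt_resolvent hz₀).vadd (hc.isCompactOperator_resolvent hz₀) 0 z
    (fun x hx ↦ (isResolventAt_resolvent hz).eq_zero_of_apply_eq (by simpa using hx))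
  have e : (0 - (z - z₀) • (1 : H →L[ℂ] H)) * resolvent T z₀ = (-(z - z₀)) • resolvent T z₀ := by
    rw [zero_sub, neg_smul, neg_mul, smul_mul_assoc, one_mul]
  rw [e, show ((0 : H →L[ℂ] H) : H →ₗ[ℂ] H) +ᵥ T = T by simp] at h
  exact ⟨h.1, h.2.resolvent_eq⟩

theorem perturbed_add (T : H →ₗ.[ℂ] H) (P : H →L[ℂ] H) (u v : ℝ) :
    perturbed T P (u + v) = perturbed (perturbed T P v) P u := by
  rw [perturbed, perturbed, perturbed, ← add_vadd, ← add_smul, Complex.ofReal_add]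

theorem isFormalAdjoint_perturbed [CompleteSpace H] {T : H →ₗ.[ℂ] H} (hT : T.IsFormalAdjoint T)
    {P : H →L[ℂ] H} (hP : IsSelfAdjoint P) (u : ℝ) :
    (perturbed T P u).IsFormalAdjoint (perturbed T P u) := by
  intro x y
  have hsymm := hP.isSymmetric (x : H) (y : H)
  have hTxy := hT x y
  simp only [ContinuousLinearMap.coe_coe] at hsymm
  change inner ℂ ((u : ℂ) • P x + T x) (y : H) = inner ℂ (x : H) ((u : ℂ) • P y + T y)
  rw [inner_add_left, inner_add_right, inner_smul_left, inner_smul_right, hTxy, hsymm]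
  simp

/-- The resolvent of `T + u P` at a nonreal point in terms of that of `T`. -/
theorem isResolventAt_perturbed [CompleteSpace H] {T : H →ₗ.[ℂ] H} (hT : T.IsFormalAdjoint T)
    (hc : HasCompactResolvent T) {P : H →L[ℂ] H} (hP : IsSelfAdjoint P) (u : ℝ) {z : ℂ}
    (hz : z.im ≠ 0) :
    IsUnit (1 + (u : ℂ) • (P * resolvent T z)) ∧ IsResolventAt (perturbed T P u) z
      (resolvent T z * Ring.inverse (1 + (u : ℂ) • (P * resolvent T z))) := by
  have hm := mem_resolventSet_of_im_ne_zero hT hc hz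
  have h := (isResolventAt_resolvent hm).vadd (hc.isCompactOperator_resolvent hm) ((u : ℂ) • P) z
    (fun x hx ↦ eq_zero_of_im_ne_zero (isFormalAdjoint_perturbed hT hP u) hz x hx)
  simp only [sub_self, zero_smul, sub_zero, smul_mul_assoc] at h
  exact h

theorem hasCompactResolvent_perturbed [CompleteSpace H] {T : H →ₗ.[ℂ] H}
    (hT : T.IsFormalAdjoint T) (hc : HasCompactResolvent T) {P : H →L[ℂ] H}
    (hP : IsSelfAdjoint P) (u : ℝ) : HasCompactResolvent (perturbed T P u) := by
  have hI : (Complex.I).im ≠ 0 := by simp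
  have h := (isResolventAt_perturbed hT hc hP u hI).2
  refine ⟨Complex.I, ⟨_, h⟩, ?_⟩
  rw [h.resolvent_eq]
  convert! (hc.isCompactOperator_resolvent
    (mem_resolventSet_of_im_ne_zero hT hc hI)).comp_clm _

/-- The resolvent of `T + u P` at a nonreal point is norm-continuous in `u`. -/
theorem continuous_resolvent_perturbed [CompleteSpace H] {T : H →ₗ.[ℂ] H}
    (hT : T.IsFormalAdjoint T) (hc : HasCompactResolvent T) {P : H →L[ℂ] H}
    (hP : IsSelfAdjoint P) {z : ℂ} (hz : z.im ≠ 0) :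
    Continuous fun u : ℝ ↦ resolvent (perturbed T P u) z := by
  simp_rw [fun u : ℝ ↦ (isResolventAt_perturbed hT hc hP u hz).2.resolvent_eq]
  refine continuous_const.mul (continuous_iff_continuousAt.mpr fun u ↦ ?_)
  obtain ⟨w, hw⟩ := (isResolventAt_perturbed hT hc hP u hz).1
  have h1 : ContinuousAt Ring.inverse (1 + (u : ℂ) • (P * resolvent T z)) :=
    hw ▸ NormedRing.inverse_continuousAt w
  exact ContinuousAt.comp (f := fun u : ℝ ↦ 1 + (u : ℂ) • (P * resolvent T z)) h1
    (by fun_prop)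

/-! ### Eigenspaces and spectral measures -/

theorem mem_eigenspace_iff {T : H →ₗ.[ℂ] H} {E : ℝ} {x : H} :
    x ∈ eigenspace T E ↔ ∃ h : x ∈ T.domain, T ⟨x, h⟩ = (E : ℂ) • x := by
  simp only [eigenspace, Submodule.mem_map, LinearMap.mem_ker, LinearMap.sub_apply,
    LinearMap.smul_apply, Submodule.subtype_apply, sub_eq_zero]
  constructor
  · rintro ⟨y, hy, rfl⟩
    exact ⟨y.2, hy⟩
  · rintro ⟨h, hx⟩
    exact ⟨⟨x, h⟩, hx, rfl⟩

theorem eigenspace_eq_bot_of_mem_resolventSet {T : H →ₗ.[ℂ] H} {E : ℝ}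
    (hE : (E : ℂ) ∈ resolventSet T) : eigenspace T E = ⊥ := by
  rw [Submodule.eq_bot_iff]
  intro x hx
  obtain ⟨h, hx⟩ := mem_eigenspace_iff.mp hx
  exact (isResolventAt_resolvent hE).eq_zero_of_apply_eq hx

theorem inner_eq_zero_of_mem_eigenspace {T : H →ₗ.[ℂ] H} (hT : T.IsFormalAdjoint T) {E E' : ℝ}
    (hE : E ≠ E') {x y : H} (hx : x ∈ eigenspace T E) (hy : y ∈ eigenspace T E') :
    inner ℂ x y = 0 := by
  obtain ⟨h, hx⟩ := mem_eigenspace_iff.mp hx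
  obtain ⟨h', hy⟩ := mem_eigenspace_iff.mp hy
  have := hT ⟨x, h⟩ ⟨y, h'⟩
  rw [hx, hy, inner_smul_left, inner_smul_right, Complex.conj_ofReal] at this
  have h3 : ((E : ℂ) - E') * inner ℂ x y = 0 := by linear_combination this
  refine (mul_eq_zero.mp h3).resolve_left ?_
  exact sub_ne_zero.mpr (by exact_mod_cast hE)

/-- An eigenvector sees the resolvent as multiplication by `(E - z)⁻¹`. -/
theorem inner_eq_mul_inner_resolvent {T : H →ₗ.[ℂ] H} (hT : T.IsFormalAdjoint T) {E : ℝ} {z : ℂ}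
    {R : H →L[ℂ] H} (hR : IsResolventAt T z R) {y : H} (hy : y ∈ eigenspace T E) (x : H) :
    inner ℂ y x = ((E : ℂ) - z) * inner ℂ y (R x) := by
  obtain ⟨h, hy⟩ := mem_eigenspace_iff.mp hy
  obtain ⟨h', hx⟩ := hR.1 x
  have h1 := hT ⟨y, h⟩ ⟨R x, h'⟩
  rw [hy, inner_smul_left, Complex.conj_ofReal] at h1
  have h2 : inner ℂ y x = inner ℂ y (T ⟨R x, h'⟩ - z • R x) := by rw [hx]
  rw [h2, inner_sub_right, inner_smul_right, ← h1]
  ring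

theorem isClosed_eigenspace [CompleteSpace H] {T : H →ₗ.[ℂ] H} (hT : T.IsFormalAdjoint T)
    (hc : HasCompactResolvent T) (E : ℝ) : IsClosed (eigenspace T E : Set H) := by
  have hI : (Complex.I).im ≠ 0 := by simp
  have hR := isResolventAt_resolvent (mem_resolventSet_of_im_ne_zero hT hc hI)
  set R := resolvent T Complex.I
  have : (eigenspace T E : Set H) = {x | ((E : ℂ) - Complex.I) • R x = x} := by
    ext x
    simp only [SetLike.mem_coe, Set.mem_ofPred_eq]
    constructor
    · intro hx
      obtain ⟨h, hx⟩ := mem_eigenspace_iff.mp hx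
      have := hR.2 ⟨x, h⟩
      rwa [hx, ← sub_smul, map_smul] at this
    · intro hx
      obtain ⟨h, he⟩ := hR.1 (((E : ℂ) - Complex.I) • x)
      have hRx : R (((E : ℂ) - Complex.I) • x) = x := by rw [map_smul, hx]
      simp only [hRx] at h he
      exact mem_eigenspace_iff.mpr ⟨h, by linear_combination (norm := module) he⟩
  rw [this]
  exact isClosed_eq (by fun_prop) continuous_id

theorem spectralProj_singleton_mem [CompleteSpace H] {T : H →ₗ.[ℂ] H} (hT : T.IsFormalAdjoint T)
    (hc : HasCompactResolvent T) (E : ℝ) (x : H) : spectralProj T {E} x ∈ eigenspace T E := by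
  have h := Submodule.starProjection_apply_mem (⨆ E' ∈ ({E} : Set ℝ),
    eigenspace T E').topologicalClosure x
  have hle : (⨆ E' ∈ ({E} : Set ℝ), eigenspace T E').topologicalClosure ≤ eigenspace T E :=
    Submodule.topologicalClosure_minimal _ (by simp) (isClosed_eigenspace hT hc E)
  exact hle h

theorem inner_spectralProj_left [CompleteSpace H] (T : H →ₗ.[ℂ] H) (I : Set ℝ) (x y : H) :
    inner ℂ (spectralProj T I x) y = inner ℂ x (spectralProj T I y) :=
  Submodule.inner_starProjection_left_eq_right _ _ _

theorem spectralProj_apply_of_mem [CompleteSpace H] {T : H →ₗ.[ℂ] H} {I : Set ℝ} {E : ℝ}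
    (hE : E ∈ I) {x : H} (hx : x ∈ eigenspace T E) : spectralProj T I x = x :=
  Submodule.starProjection_eq_self_iff.mpr <| Submodule.le_topologicalClosure _ <|
    Submodule.mem_iSup_of_mem E (Submodule.mem_iSup_of_mem hE hx)

theorem spectralProj_apply_of_notMem [CompleteSpace H] {T : H →ₗ.[ℂ] H}
    (hT : T.IsFormalAdjoint T) {I : Set ℝ} {E : ℝ}
    (hE : E ∉ I) {x : H} (hx : x ∈ eigenspace T E) : spectralProj T I x = 0 := by
  rw [spectralProj, Submodule.starProjection_apply_eq_zero_iff, Submodule.orthogonal_closure]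
  rw [Submodule.mem_orthogonal]
  intro y hy
  have hle : (⨆ E' ∈ I, eigenspace T E') ≤ (ℂ ∙ x)ᗮ := by
    refine iSup₂_le fun E' hE' y hy ↦ ?_
    rw [Submodule.mem_orthogonal_singleton_iff_inner_left]
    exact inner_eq_zero_of_mem_eigenspace hT (by rintro rfl; exact hE hE') hy hx
  exact Submodule.mem_orthogonal_singleton_iff_inner_left.mp (hle hy)

theorem inner_spectralProj_of_mem [CompleteSpace H] {T : H →ₗ.[ℂ] H} {E : ℝ} {y : H}
    (hy : y ∈ eigenspace T E) (x : H) :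
    inner ℂ y (spectralProj T {E} x) = inner ℂ y x := by
  rw [← inner_spectralProj_left, spectralProj_apply_of_mem (Set.mem_singleton E) hy]

theorem inner_spectralProj_spectralProj [CompleteSpace H] {T : H →ₗ.[ℂ] H}
    (hT : T.IsFormalAdjoint T) (hc : HasCompactResolvent T) (E : ℝ) (x y : H) :
    inner ℂ (spectralProj T {E} x) (spectralProj T {E} y) = inner ℂ x (spectralProj T {E} y) := by
  rw [inner_spectralProj_left, spectralProj_apply_of_mem (Set.mem_singleton _)
    (spectralProj_singleton_mem hT hc _ _)]

/-- The projection onto an eigenspace is characterised by its inner products with eigenvectors. -/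
theorem spectralProj_singleton_eq [CompleteSpace H] {T : H →ₗ.[ℂ] H} (hT : T.IsFormalAdjoint T)
    (hc : HasCompactResolvent T) {E : ℝ} {x w : H} (hw : w ∈ eigenspace T E)
    (h : ∀ y ∈ eigenspace T E, inner ℂ y w = inner ℂ y x) : spectralProj T {E} x = w := by
  have hm := spectralProj_singleton_mem hT hc E x
  rw [← sub_eq_zero, ← inner_self_eq_zero (𝕜 := ℂ)]
  have hd := Submodule.sub_mem _ hm hw
  rw [inner_sub_right, inner_spectralProj_of_mem hd, h _ hd, sub_self]

theorem spectralProj_singleton_resolvent [CompleteSpace H] {T : H →ₗ.[ℂ] H}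
    (hT : T.IsFormalAdjoint T) (hc : HasCompactResolvent T) {E : ℝ} {z : ℂ} (hz : (E : ℂ) - z ≠ 0)
    {R : H →L[ℂ] H} (hR : IsResolventAt T z R) (x : H) :
    spectralProj T {E} (R x) = ((E : ℂ) - z)⁻¹ • spectralProj T {E} x := by
  refine spectralProj_singleton_eq hT hc
    (Submodule.smul_mem _ _ (spectralProj_singleton_mem hT hc E x)) fun y hy ↦ ?_
  rw [inner_smul_right, inner_spectralProj_of_mem hy, inner_eq_mul_inner_resolvent hT hR hy,
    inv_mul_cancel_left₀ hz]

theorem spectralProj_singleton_spectralProj [CompleteSpace H] {T : H →ₗ.[ℂ] H}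
    (hT : T.IsFormalAdjoint T) (hc : HasCompactResolvent T) (I : Set ℝ) (E : ℝ) (x : H) :
    spectralProj T {E} (spectralProj T I x) = I.indicator (fun E ↦ spectralProj T {E} x) E := by
  by_cases hE : E ∈ I
  · rw [Set.indicator_of_mem hE]
    refine spectralProj_singleton_eq hT hc (spectralProj_singleton_mem hT hc E x) fun y hy ↦ ?_
    rw [inner_spectralProj_of_mem hy, ← inner_spectralProj_left, spectralProj_apply_of_mem hE hy]
  · rw [Set.indicator_of_notMem hE]
    refine spectralProj_singleton_eq hT hc (Submodule.zero_mem _) fun y hy ↦ ?_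
    rw [← inner_spectralProj_left, spectralProj_apply_of_notMem hT hE hy, inner_zero_left,
      inner_zero_right]

theorem countable_of_orthonormal [TopologicalSpace.SeparableSpace H] {ι : Type*} {e : ι → H}
    (he : Orthonormal ℂ e) : Countable ι := by
  refine Pairwise.countable_of_isOpen_disjoint (s := fun i ↦ Metric.ball (e i) (1 / 2))
    (fun i j hij ↦ Metric.ball_disjoint_ball ?_) (fun _ ↦ Metric.isOpen_ball)
    (fun i ↦ ⟨e i, by simp⟩)
  have := norm_sub_sq (𝕜 := ℂ) (e i) (e j)
  rw [he.2 hij, he.1, he.1] at this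
  simp only [map_zero] at this
  rw [dist_eq_norm]
  nlinarith [norm_nonneg (e i - e j)]

theorem countable_setOf_eigenspace_ne_bot [TopologicalSpace.SeparableSpace H] {T : H →ₗ.[ℂ] H}
    (hT : T.IsFormalAdjoint T) : {E : ℝ | eigenspace T E ≠ ⊥}.Countable := by
  have hex (E : {E : ℝ | eigenspace T E ≠ ⊥}) : ∃ x ∈ eigenspace T E, ‖x‖ = 1 := by
    obtain ⟨x, hx, hx0⟩ := Submodule.exists_mem_ne_zero_of_ne_bot E.2
    exact ⟨((‖x‖ : ℂ)⁻¹) • x, Submodule.smul_mem _ _ hx, by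
      rw [norm_smul]; simp [norm_ne_zero_iff.mpr hx0]⟩
  choose x hx hx1 using hex
  exact Set.countable_coe_iff.mp <| countable_of_orthonormal (e := x) ⟨hx1, fun E E' hne ↦
    inner_eq_zero_of_mem_eigenspace hT (Subtype.coe_ne_coe.mpr hne) (hx E) (hx E')⟩

/-- Compactness of the resolvent makes the real spectrum consist of eigenvalues. -/
theorem countable_real_spectrum [CompleteSpace H] [TopologicalSpace.SeparableSpace H]
    {T : H →ₗ.[ℂ] H} (hT : T.IsFormalAdjoint T) (hc : HasCompactResolvent T) :
    {E : ℝ | (E : ℂ) ∉ resolventSet T}.Countable := by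
  refine (countable_setOf_eigenspace_ne_bot hT).mono fun E hE ↦ ?_
  rw [Set.mem_ofPred_eq] at hE ⊢
  refine fun hbot ↦ hE ?_
  obtain ⟨R, hR, -⟩ := hc.exists_isResolventAt (z := E) fun x hx ↦ by
    have : (x : H) ∈ eigenspace T E := mem_eigenspace_iff.mpr ⟨x.2, hx⟩
    simpa [hbot] using this
  exact ⟨R, hR⟩

theorem inner_resolvent_left {T : H →ₗ.[ℂ] H} (hT : T.IsFormalAdjoint T) {E : ℝ}
    {R : H →L[ℂ] H} (hR : IsResolventAt T E R) (x y : H) :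
    inner ℂ (R x) y = inner ℂ x (R y) := by
  obtain ⟨h, hx⟩ := hR.1 x
  obtain ⟨h', hy⟩ := hR.1 y
  have h1 := hT ⟨R x, h⟩ ⟨R y, h'⟩
  conv_lhs => rw [← hy]
  conv_rhs => rw [← hx]
  rw [inner_sub_left, inner_sub_right, inner_smul_left, inner_smul_right, h1, Complex.conj_ofReal]

theorem topologicalClosure_iSup_eigenspace [CompleteSpace H] [TopologicalSpace.SeparableSpace H]
    {T : H →ₗ.[ℂ] H} (hT : T.IsFormalAdjoint T) (hc : HasCompactResolvent T) :
    (⨆ E, eigenspace T E).topologicalClosure = ⊤ := by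
  -- a real point of the resolvent set, where the resolvent is compact and symmetric
  obtain ⟨l, hl⟩ := ((countable_real_spectrum hT hc).dense_compl ℝ).nonempty
  rw [Set.mem_compl_iff, Set.mem_ofPred_eq, not_not] at hl
  have hR := isResolventAt_resolvent hl
  have hRc := hc.isCompactOperator_resolvent hl
  set R := resolvent T l
  have hsymm : (R : H →ₗ[ℂ] H).IsSymmetric := inner_resolvent_left hT hR
  have hbot := ContinuousLinearMap.orthogonalComplement_iSup_eigenspaces_eq_bot hRc hsymm
  rw [Submodule.topologicalClosure_eq_top_iff, ← le_bot_iff, ← hbot]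
  refine Submodule.orthogonal_le (iSup_le fun μ x hx ↦ ?_)
  rcases eq_or_ne x 0 with rfl | hx0
  · exact Submodule.zero_mem _
  have hreal := hsymm.conj_eigenvalue_eq_self
    (Module.End.hasEigenvalue_of_hasEigenvector ⟨hx, hx0⟩)
  have hx : R x = μ • x := Module.End.mem_eigenspace_iff.mp hx
  obtain ⟨m, rfl⟩ := Complex.conj_eq_iff_real.mp hreal
  obtain ⟨h, he⟩ := hR.1 x
  have hm : (m : ℂ) ≠ 0 := by
    intro h0
    rw [h0, zero_smul] at hx
    simp only [hx] at he
    refine hx0 (he.symm.trans ?_)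
    rw [smul_zero, sub_zero]
    exact T.map_zero
  refine Submodule.mem_iSup_of_mem (l + m⁻¹) (mem_eigenspace_iff.mpr ?_)
  simp only [hx] at h he
  have hxd : x ∈ T.domain := by
    simpa only [inv_smul_smul₀ hm] using T.domain.smul_mem (m : ℂ)⁻¹ h
  refine ⟨hxd, ?_⟩
  have h2 : T ⟨(m : ℂ) • x, h⟩ = (m : ℂ) • T ⟨x, hxd⟩ := T.map_smul (m : ℂ) ⟨x, hxd⟩
  rw [h2] at he
  have h3 : (m : ℂ)⁻¹ • ((m : ℂ) • T ⟨x, hxd⟩ - (l : ℂ) • (m : ℂ) • x) = (m : ℂ)⁻¹ • x := by rw [he]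
  rw [smul_sub, inv_smul_smul₀ hm, smul_comm (l : ℂ), inv_smul_smul₀ hm] at h3
  push_cast
  linear_combination (norm := module) h3

/-- Parseval's identity for the eigenspace decomposition. -/
theorem tsum_enorm_spectralProj_sq [CompleteSpace H] [TopologicalSpace.SeparableSpace H]
    {T : H →ₗ.[ℂ] H} (hT : T.IsFormalAdjoint T) (hc : HasCompactResolvent T) (x : H) :
    ∑' E : ℝ, ‖spectralProj T {E} x‖ₑ ^ 2 = ‖x‖ₑ ^ 2 := by
  have (E : ℝ) : CompleteSpace (eigenspace T E) := (isClosed_eigenspace hT hc E).completeSpace_coe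
  have hortho : OrthogonalFamily ℂ (fun E ↦ eigenspace T E) fun E ↦ (eigenspace T E).subtypeₗᵢ :=
    fun E E' hne v w ↦ inner_eq_zero_of_mem_eigenspace hT hne v.2 w.2
  have hsum := IsHilbertSum.mkInternal _ hortho (topologicalClosure_iSup_eigenspace hT hc).ge
  set w := hsum.linearIsometryEquiv x with hw
  have hx := hsum.hasSum_linearIsometryEquiv_symm w
  rw [hw, LinearIsometryEquiv.symm_apply_apply, ← hw] at hx
  have hproj (E : ℝ) : spectralProj T {E} x = w E := by
    refine spectralProj_singleton_eq hT hc (w E).2 fun y hy ↦ ?_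
    have h1 := hx.mapL (innerSL ℂ y)
    have h2 := hasSum_single (f := fun E' ↦ innerSL ℂ y ((eigenspace T E').subtypeₗᵢ (w E'))) E
      fun E' hne ↦ inner_eq_zero_of_mem_eigenspace hT hne.symm hy (w E').2
    exact h2.unique h1
  have hn := lp.hasSum_norm (p := 2) (by simp) w
  rw [LinearIsometryEquiv.norm_map] at hn
  simp only [ENNReal.toReal_ofNat, Real.rpow_ofNat] at hn
  have hE (y : H) : ‖y‖ₑ ^ 2 = ENNReal.ofReal (‖y‖ ^ 2) := by
    rw [ENNReal.ofReal_pow (norm_nonneg _), ofReal_norm]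
  simp_rw [hproj, hE]
  rw [← hn.tsum_eq, ENNReal.ofReal_tsum_of_nonneg (fun _ ↦ by positivity) hn.summable]
  rfl

/-- The spectral measure `B ↦ ‖P_B(T) x‖²` of a vector, as a sum of point masses at the
eigenvalues. -/
noncomputable def specMeasure [CompleteSpace H] (T : H →ₗ.[ℂ] H) (x : H) : Measure ℝ :=
  Measure.sum fun E : ℝ ↦ ‖spectralProj T {E} x‖ₑ ^ 2 • Measure.dirac E

theorem lintegral_specMeasure [CompleteSpace H] (T : H →ₗ.[ℂ] H) (x : H) (f : ℝ → ℝ≥0∞) :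
    ∫⁻ E, f E ∂specMeasure T x = ∑' E, ‖spectralProj T {E} x‖ₑ ^ 2 * f E := by
  rw [specMeasure, lintegral_sum_measure]
  simp

theorem specMeasure_apply [CompleteSpace H] (T : H →ₗ.[ℂ] H) (x : H) {B : Set ℝ}
    (hB : MeasurableSet B) :
    specMeasure T x B = ∑' E, B.indicator (fun E ↦ ‖spectralProj T {E} x‖ₑ ^ 2) E := by
  rw [← lintegral_indicator_one hB, lintegral_specMeasure]
  refine tsum_congr fun E ↦ ?_
  by_cases hE : E ∈ B <;> simp [hE]

theorem specMeasure_singleton [CompleteSpace H] (T : H →ₗ.[ℂ] H) (x : H) (E : ℝ) :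
    specMeasure T x {E} = ‖spectralProj T {E} x‖ₑ ^ 2 := by
  rw [specMeasure_apply T x (measurableSet_singleton E),
    tsum_eq_single E fun E' h ↦ by simp [h]]
  simp

theorem specMeasure_univ [CompleteSpace H] [TopologicalSpace.SeparableSpace H]
    {T : H →ₗ.[ℂ] H} (hT : T.IsFormalAdjoint T) (hc : HasCompactResolvent T) (x : H) :
    specMeasure T x Set.univ = ‖x‖ₑ ^ 2 := by
  rw [specMeasure_apply T x MeasurableSet.univ, ← tsum_enorm_spectralProj_sq hT hc]
  simp

theorem specMeasure_eq_enorm_spectralProj_sq [CompleteSpace H] [TopologicalSpace.SeparableSpace H]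
    {T : H →ₗ.[ℂ] H} (hT : T.IsFormalAdjoint T) (hc : HasCompactResolvent T) (x : H)
    {I : Set ℝ} (hI : MeasurableSet I) :
    specMeasure T x I = ‖spectralProj T I x‖ₑ ^ 2 := by
  rw [specMeasure_apply T x hI, ← tsum_enorm_spectralProj_sq hT hc]
  refine tsum_congr fun E ↦ ?_
  rw [spectralProj_singleton_spectralProj hT hc]
  by_cases hE : E ∈ I <;> simp [hE]

/-! ### Measurable dependence on the coupling -/

/-- The polynomials `(1 - (1 - t)ⁿ) ^ (n 2ⁿ)` converge on `[0, 1]` to the indicator function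
of `(1/2, 1]`. The factor `n` in the exponent makes the limit at `t = 1/2` equal to `0`. -/
theorem tendsto_one_sub_one_sub_pow_pow {t : ℝ} (h0 : 0 ≤ t) (h1 : t ≤ 1) :
    Filter.Tendsto (fun n : ℕ ↦ (1 - (1 - t) ^ n) ^ (n * 2 ^ n)) Filter.atTop
      (nhds ((Set.Ioi (1 / 2 : ℝ)).indicator 1 t)) := by
  have hx0 (n : ℕ) : 0 ≤ (1 - t) ^ n := pow_nonneg (by linarith) n
  have hx1 (n : ℕ) : (1 - t) ^ n ≤ 1 := pow_le_one₀ (by linarith) (by linarith)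
  have hmul (n : ℕ) : ((n * 2 ^ n : ℕ) : ℝ) * (1 - t) ^ n = n * (2 * (1 - t)) ^ n := by
    push_cast; rw [mul_pow]; ring
  by_cases ht : 1 / 2 < t
  · rw [Set.indicator_of_mem (Set.mem_Ioi.mpr ht), Pi.one_apply]
    have hlim := tendsto_self_mul_const_pow_of_lt_one (r := 2 * (1 - t)) (by linarith)
      (by linarith)
    have hlim' := hlim.const_sub 1
    rw [sub_zero] at hlim'
    refine tendsto_of_tendsto_of_tendsto_of_le_of_le hlim' tendsto_const_nhds (fun n ↦ ?_)
      fun n ↦ pow_le_one₀ (by linarith [hx1 n]) (by linarith [hx0 n])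
    have := one_add_mul_le_pow (a := -(1 - t) ^ n) (by linarith [hx1 n]) (n * 2 ^ n)
    rw [mul_neg, hmul] at this
    simpa [sub_eq_add_neg] using this
  · rw [Set.indicator_of_notMem (by simpa using ht)]
    have hlim := Real.tendsto_exp_neg_atTop_nhds_zero.comp tendsto_natCast_atTop_atTop (α := ℕ)
    refine tendsto_of_tendsto_of_tendsto_of_le_of_le tendsto_const_nhds hlim
      (fun n ↦ pow_nonneg (by linarith [hx1 n]) _) fun n ↦ ?_
    have hb : 1 - (1 - t) ^ n ≤ Real.exp (-(1 - t) ^ n) := by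
      linarith [Real.add_one_le_exp (-(1 - t) ^ n)]
    refine (pow_le_pow_left₀ (by linarith [hx1 n]) hb _).trans ?_
    rw [← Real.exp_nat_mul, mul_neg, hmul, Function.comp_apply, Real.exp_le_exp, neg_le_neg_iff]
    exact le_mul_of_one_le_right (by positivity) (one_le_pow₀ (by linarith))

/-- `r² |T - c - i r|⁻²`, a function of `T` exceeding `1/2` exactly on `(c - r, c + r)`. -/
noncomputable def lorentzian (T : H →ₗ.[ℂ] H) (c r : ℝ) : H →L[ℂ] H :=
  ((r ^ 2 : ℝ) : ℂ) • (resolvent T (c + r * Complex.I) * resolvent T (c - r * Complex.I))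

theorem spectralProj_mul_lorentzian [CompleteSpace H] {T : H →ₗ.[ℂ] H} (hT : T.IsFormalAdjoint T)
    (hc : HasCompactResolvent T) (c : ℝ) {r : ℝ} (hr : 0 < r) (E : ℝ) :
    spectralProj T {E} * lorentzian T c r =
      ((r ^ 2 / ((E - c) ^ 2 + r ^ 2) : ℝ) : ℂ) • spectralProj T {E} := by
  have h1 : ((c : ℂ) + r * Complex.I).im ≠ 0 := by simp [hr.ne']
  have h2 : ((c : ℂ) - r * Complex.I).im ≠ 0 := by simp [hr.ne']
  have h3 : (E : ℂ) - (c + r * Complex.I) ≠ 0 := fun h ↦ by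
    simpa [hr.ne'] using congrArg Complex.im h
  have h4 : (E : ℂ) - (c - r * Complex.I) ≠ 0 := fun h ↦ by
    simpa [hr.ne'] using congrArg Complex.im h
  ext x
  simp only [lorentzian, mul_apply_eq_comp, smul_apply, map_smul]
  rw [spectralProj_singleton_resolvent hT hc h3
      (isResolventAt_resolvent (mem_resolventSet_of_im_ne_zero hT hc h1)),
    spectralProj_singleton_resolvent hT hc h4
      (isResolventAt_resolvent (mem_resolventSet_of_im_ne_zero hT hc h2)), smul_smul, smul_smul]
  congr 1
  rw [mul_assoc, ← mul_inv, ← div_eq_mul_inv]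
  push_cast
  congr 1
  linear_combination (r : ℂ) ^ 2 * Complex.I_sq.symm

/-- Powers of the function `1 - (1 - lorentzian)ⁿ` approximate spectral projections. -/
theorem tendsto_enorm_lorentzian_pow [CompleteSpace H] [TopologicalSpace.SeparableSpace H]
    {T : H →ₗ.[ℂ] H} (hT : T.IsFormalAdjoint T) (hc : HasCompactResolvent T) (x : H) (c : ℝ)
    {r : ℝ} (hr : 0 < r) :
    Filter.Tendsto
      (fun n : ℕ ↦ ‖((1 - (1 - lorentzian T c r) ^ n) ^ (n * 2 ^ n)) x‖ₑ ^ 2) Filter.atTop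
      (nhds (specMeasure T x (Set.Ioo (c - r) (c + r)))) := by
  set f : ℝ → ℝ := fun E ↦ r ^ 2 / ((E - c) ^ 2 + r ^ 2) with hf
  have hf0 (E : ℝ) : 0 ≤ f E := by positivity
  have hf1 (E : ℝ) : f E ≤ 1 := by
    rw [hf, div_le_one (by positivity)]
    nlinarith [sq_nonneg (E - c)]
  set g : ℕ → ℝ → ℝ := fun n E ↦ (1 - (1 - f E) ^ n) ^ (n * 2 ^ n) with hg
  have hg0 (n : ℕ) (E : ℝ) : 0 ≤ g n E :=
    pow_nonneg (sub_nonneg.mpr (pow_le_one₀ (sub_nonneg.mpr (hf1 E)) (by linarith [hf0 E]))) _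
  have hg1 (n : ℕ) (E : ℝ) : g n E ≤ 1 := by
    have := pow_nonneg (sub_nonneg.mpr (hf1 E)) n
    refine pow_le_one₀ ?_ (by linarith)
    exact sub_nonneg.mpr (pow_le_one₀ (sub_nonneg.mpr (hf1 E)) (by linarith [hf0 E]))
  have hfm : Measurable f := by fun_prop
  have hsmul {S : H →L[ℂ] H} {a : ℂ} {E : ℝ} (h : spectralProj T {E} * S = a • spectralProj T {E})
      (n : ℕ) : spectralProj T {E} * S ^ n = a ^ n • spectralProj T {E} := by
    induction n with
    | zero => simp
    | succ k ih => rw [pow_succ, ← mul_assoc, ih, smul_mul_assoc, h, smul_smul, pow_succ]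
  have hsub {S : H →L[ℂ] H} {a : ℂ} {E : ℝ} (h : spectralProj T {E} * S = a • spectralProj T {E}) :
      spectralProj T {E} * (1 - S) = (1 - a) • spectralProj T {E} := by
    rw [mul_sub, h, mul_one, sub_smul, one_smul]
  have hop (n : ℕ) : ‖((1 - (1 - lorentzian T c r) ^ n) ^ (n * 2 ^ n)) x‖ₑ ^ 2 =
      ∫⁻ E, ENNReal.ofReal (g n E) ^ 2 ∂specMeasure T x := by
    rw [← tsum_enorm_spectralProj_sq hT hc, lintegral_specMeasure]
    refine tsum_congr fun E ↦ ?_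
    have h := hsmul (hsub (hsmul (hsub (spectralProj_mul_lorentzian hT hc c hr E)) n)) (n * 2 ^ n)
    have h' := DFunLike.congr_fun h x
    rw [mul_apply_eq_comp] at h'
    rw [h', smul_apply, enorm_smul, mul_pow, mul_comm]
    congr 2
    have : (1 - (1 - ((f E : ℝ) : ℂ)) ^ n) ^ (n * 2 ^ n) = ((g n E : ℝ) : ℂ) := by
      simp only [hg]; push_cast; rfl
    rw [this, ← ofReal_norm, Complex.norm_real, Real.norm_of_nonneg (hg0 n E)]
  simp_rw [hop]
  rw [← lintegral_indicator_one measurableSet_Ioo]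
  refine tendsto_lintegral_of_dominated_convergence (fun _ ↦ 1)
    (fun n ↦ by fun_prop) (fun n ↦ .of_forall fun E ↦ ?_) ?_ (.of_forall fun E ↦ ?_)
  · exact pow_le_one₀ (by simp) (by simpa using hg1 n E)
  · rw [lintegral_one, specMeasure_univ hT hc]
    exact ENNReal.pow_ne_top enorm_ne_top
  · have h := (ENNReal.continuous_ofReal.tendsto _).comp
      (tendsto_one_sub_one_sub_pow_pow (hf0 E) (hf1 E))
    have h2 := ENNReal.Tendsto.pow (n := 2) h
    convert! h2 using 2
    have hiff : E ∈ Set.Ioo (c - r) (c + r) ↔ f E ∈ Set.Ioi (1 / 2 : ℝ) := by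
      rw [Set.mem_Ioi, hf, div_lt_div_iff₀ (by norm_num) (by positivity), ← Real.ball_eq_Ioo,
        Metric.mem_ball, Real.dist_eq, ← sq_lt_sq₀ (abs_nonneg _) hr.le, sq_abs]
      constructor <;> intro h <;> linarith
    by_cases hE : E ∈ Set.Ioo (c - r) (c + r)
    · rw [Set.indicator_of_mem hE, Set.indicator_of_mem (hiff.mp hE)]; simp
    · rw [Set.indicator_of_notMem hE, Set.indicator_of_notMem (mt hiff.mpr hE)]; simp

theorem isFiniteMeasure_specMeasure [CompleteSpace H] [TopologicalSpace.SeparableSpace H]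
    {T : H →ₗ.[ℂ] H} (hT : T.IsFormalAdjoint T) (hc : HasCompactResolvent T) (x : H) :
    IsFiniteMeasure (specMeasure T x) :=
  ⟨by rw [specMeasure_univ hT hc]; exact ENNReal.pow_lt_top enorm_lt_top⟩

theorem measurable_specMeasure_perturbed [CompleteSpace H] [TopologicalSpace.SeparableSpace H]
    {T : H →ₗ.[ℂ] H} (hT : T.IsFormalAdjoint T) (hc : HasCompactResolvent T) {P : H →L[ℂ] H}
    (hP : IsSelfAdjoint P) (x : H) :
    Measurable fun u : ℝ ↦ specMeasure (perturbed T P u) x := by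
  have hTu (u : ℝ) := isFormalAdjoint_perturbed hT hP u
  have hcu (u : ℝ) := hasCompactResolvent_perturbed hT hc hP u
  have (u : ℝ) := isFiniteMeasure_specMeasure (hTu u) (hcu u) x
  refine Measurable.measure_of_isPiSystem
    (BorelSpace.measurable_eq.trans Real.borel_eq_generateFrom_Ioo_rat)
    Real.isPiSystem_Ioo_rat (fun s hs ↦ ?_) ?_
  · simp only [Set.mem_iUnion, Set.mem_singleton_iff] at hs
    obtain ⟨p, q, hpq, rfl⟩ := hs
    obtain ⟨a, ha⟩ : ∃ a : ℝ, a = p := ⟨_, rfl⟩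
    obtain ⟨b, hb⟩ : ∃ b : ℝ, b = q := ⟨_, rfl⟩
    rw [← ha, ← hb]
    have hab : a < b := by rw [ha, hb]; exact_mod_cast hpq
    have hr : 0 < (b - a) / 2 := by linarith
    have e : Set.Ioo a b = Set.Ioo ((a + b) / 2 - (b - a) / 2) ((a + b) / 2 + (b - a) / 2) := by
      congr 1 <;> ring
    rw [e]
    refine measurable_of_tendsto_metrizable (fun n ↦ ?_) (tendsto_pi_nhds.mpr fun u ↦
      tendsto_enorm_lorentzian_pow (hTu u) (hcu u) x ((a + b) / 2) hr)
    have him : ((((a + b) / 2 : ℝ) : ℂ) + ((b - a) / 2 : ℝ) * Complex.I).im ≠ 0 := by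
      simpa [sub_eq_zero] using hab.ne'
    have him' : ((((a + b) / 2 : ℝ) : ℂ) - ((b - a) / 2 : ℝ) * Complex.I).im ≠ 0 := by
      simpa [sub_eq_zero] using hab.ne'
    have hcont : Continuous fun u ↦ lorentzian (perturbed T P u) ((a + b) / 2) ((b - a) / 2) := by
      have h1 := continuous_resolvent_perturbed hT hc hP him
      have h2 := continuous_resolvent_perturbed hT hc hP him'
      unfold lorentzian
      fun_prop
    refine Continuous.measurable ?_
    fun_prop
  · simp_rw [fun u ↦ specMeasure_univ (hTu u) (hcu u) x]
    exact measurable_const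

/-- The mass of `{E}` is jointly measurable in the coupling and `E`, since the diagonal is a
measurable set. -/
theorem measurable_enorm_spectralProj_sq [CompleteSpace H] [TopologicalSpace.SeparableSpace H]
    {T : H →ₗ.[ℂ] H} (hT : T.IsFormalAdjoint T) (hc : HasCompactResolvent T) {P : H →L[ℂ] H}
    (hP : IsSelfAdjoint P) (x : H) :
    Measurable fun p : ℝ × ℝ ↦ ‖spectralProj (perturbed T P p.1) {p.2} x‖ₑ ^ 2 := by
  let κ : ProbabilityTheory.Kernel (ℝ × ℝ) ℝ :=
    ⟨fun p ↦ specMeasure (perturbed T P p.1) x,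
      (measurable_specMeasure_perturbed hT hc hP x).comp measurable_fst⟩
  have : ProbabilityTheory.IsFiniteKernel κ := ⟨‖x‖ₑ ^ 2, ENNReal.pow_lt_top enorm_lt_top,
    fun p ↦ (specMeasure_univ (isFormalAdjoint_perturbed hT hP p.1)
      (hasCompactResolvent_perturbed hT hc hP p.1) x).le⟩
  have hm : MeasurableSet {q : (ℝ × ℝ) × ℝ | q.2 = q.1.2} :=
    measurableSet_eq_fun measurable_snd measurable_fst.snd
  have h := ProbabilityTheory.Kernel.measurable_kernel_prodMk_left (κ := κ) hm
  convert! h using 2 with p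
  exact (specMeasure_singleton _ x p.2).symm

theorem measurable_enorm_inner_spectralProj [CompleteSpace H] [TopologicalSpace.SeparableSpace H]
    {T : H →ₗ.[ℂ] H} (hT : T.IsFormalAdjoint T) (hc : HasCompactResolvent T) {P : H →L[ℂ] H}
    (hP : IsSelfAdjoint P) (x y : H) :
    Measurable fun p : ℝ × ℝ ↦ ‖inner ℂ x (spectralProj (perturbed T P p.1) {p.2} y)‖ₑ := by
  have hn (w : H) : Measurable fun p : ℝ × ℝ ↦
      ((‖spectralProj (perturbed T P p.1) {p.2} w‖ : ℝ) : ℂ) ^ 2 := by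
    have h := (measurable_enorm_spectralProj_sq hT hc hP w).ennreal_toReal
    simp only [ENNReal.toReal_pow, toReal_enorm] at h
    exact_mod_cast Complex.measurable_ofReal.comp h
  refine Measurable.enorm ?_
  simp_rw [fun p : ℝ × ℝ ↦ (inner_spectralProj_spectralProj (isFormalAdjoint_perturbed hT hP p.1)
    (hasCompactResolvent_perturbed hT hc hP p.1) p.2 x y).symm, inner_eq_sum_norm_sq_div_four,
    ← map_smul, ← map_add, ← map_sub]
  exact (((hn _).sub (hn _)).add (((hn _).sub (hn _)).mul_const _)).div_const _

theorem correlator_eq_tsum [CompleteSpace H] {T : H →ₗ.[ℂ] H} (hT : T.IsFormalAdjoint T)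
    (hc : HasCompactResolvent T) (φ ψ : H) (I : Set ℝ) :
    correlator T φ ψ I =
      ∑' E : ℝ, I.indicator (fun E ↦ ‖inner ℂ φ (spectralProj T {E} ψ)‖ₑ) E := by
  let s : Set ℝ := {E : ℝ | (E : ℂ) ∈ spectrum T ∧ E ∈ I}
  have h : correlator T φ ψ I =
      ∑' E : ℝ, s.indicator (fun E ↦ ‖inner ℂ φ (spectralProj T {E} ψ)‖ₑ) E :=
    tsum_subtype s fun E ↦ ‖inner ℂ φ (spectralProj T {E} ψ)‖ₑ
  rw [h]
  refine tsum_congr fun E ↦ ?_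
  by_cases hE : E ∈ I
  · by_cases hs : (E : ℂ) ∈ spectrum T
    · rw [Set.indicator_of_mem (show E ∈ s from ⟨hs, hE⟩), Set.indicator_of_mem hE]
    · have h0 := spectralProj_singleton_mem hT hc E ψ
      rw [eigenspace_eq_bot_of_mem_resolventSet (not_not.mp hs), Submodule.mem_bot] at h0
      simp [Set.indicator, h0]
  · rw [Set.indicator_of_notMem (fun h : E ∈ s ↦ hE h.2), Set.indicator_of_notMem hE]

/-- The correlator is the integral, against the spectral measure of `ψ`, of a jointly measurable
density. -/
theorem measurable_correlator_perturbed [CompleteSpace H] [TopologicalSpace.SeparableSpace H]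
    {T : H →ₗ.[ℂ] H} (hT : T.IsFormalAdjoint T) (hc : HasCompactResolvent T) {P : H →L[ℂ] H}
    (hP : IsSelfAdjoint P) (φ ψ : H) {I : Set ℝ} (hI : MeasurableSet I) :
    Measurable fun u : ℝ ↦ correlator (perturbed T P u) φ ψ I := by
  let κ : ProbabilityTheory.Kernel ℝ ℝ :=
    ⟨fun u ↦ specMeasure (perturbed T P u) ψ, measurable_specMeasure_perturbed hT hc hP ψ⟩
  have : ProbabilityTheory.IsFiniteKernel κ := ⟨‖ψ‖ₑ ^ 2, ENNReal.pow_lt_top enorm_lt_top,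
    fun p ↦ (specMeasure_univ (isFormalAdjoint_perturbed hT hP p)
      (hasCompactResolvent_perturbed hT hc hP p) ψ).le⟩
  -- where the spectral measure has no atom the summand vanishes, matching the value `0 / 0 = 0`
  let f : ℝ → ℝ → ℝ≥0∞ := fun u E ↦
    I.indicator 1 E * (‖inner ℂ φ (spectralProj (perturbed T P u) {E} ψ)‖ₑ /
      ‖spectralProj (perturbed T P u) {E} ψ‖ₑ ^ 2)
  have hf : Measurable (Function.uncurry f) :=
    ((measurable_one.indicator hI).comp measurable_snd).mul
      ((measurable_enorm_inner_spectralProj hT hc hP φ ψ).div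
        (measurable_enorm_spectralProj_sq hT hc hP ψ))
  convert! Measurable.lintegral_kernel_prod_right (κ := κ) hf using 2 with u
  rw [correlator_eq_tsum (isFormalAdjoint_perturbed hT hP u)
    (hasCompactResolvent_perturbed hT hc hP u)]
  change _ = ∫⁻ E, f u E ∂specMeasure (perturbed T P u) ψ
  rw [lintegral_specMeasure]
  refine tsum_congr fun E ↦ ?_
  by_cases hE : E ∈ I
  · rw [Set.indicator_of_mem hE]
    simp only [f, Set.indicator_of_mem hE, Pi.one_apply, one_mul]
    by_cases h0 : spectralProj (perturbed T P u) {E} ψ = 0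
    · simp [h0]
    · rw [ENNReal.mul_div_cancel (by simpa using h0) (ENNReal.pow_ne_top enorm_ne_top)]
  · simp [f, hE]

theorem measurable_enorm_spectralProj_perturbed [CompleteSpace H]
    [TopologicalSpace.SeparableSpace H]
    {T : H →ₗ.[ℂ] H} (hT : T.IsFormalAdjoint T) (hc : HasCompactResolvent T) {P : H →L[ℂ] H}
    (hP : IsSelfAdjoint P) (ψ : H) {I : Set ℝ} (hI : MeasurableSet I) :
    Measurable fun u : ℝ ↦ ‖spectralProj (perturbed T P u) I ψ‖ₑ := by
  have h := (Measure.measurable_coe hI).comp (measurable_specMeasure_perturbed hT hc hP ψ)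
  have h2 := h.pow_const (1 / 2 : ℝ)
  convert! h2 using 2 with u
  rw [Function.comp_apply, specMeasure_eq_enorm_spectralProj_sq (isFormalAdjoint_perturbed hT hP u)
    (hasCompactResolvent_perturbed hT hc hP u) ψ hI, ← ENNReal.rpow_natCast, ← ENNReal.rpow_mul]
  simp

/-! ### Complex couplings and the Poisson formula -/

/-- The resolvent `(T + w P - z)⁻¹` for a complex coupling `w`. -/
noncomputable def cplxResolvent (T : H →ₗ.[ℂ] H) (P : H →L[ℂ] H) (z w : ℂ) : H →L[ℂ] H :=
  resolvent T z * Ring.inverse (1 + w • (P * resolvent T z))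

theorem inner_apply_self_of_isStarProjection [CompleteSpace H] {P : H →L[ℂ] H}
    (hP : IsStarProjection P) (x : H) : inner ℂ x (P x) = ((‖P x‖ ^ 2 : ℝ) : ℂ) := by
  have h1 : P (P x) = P x := DFunLike.congr_fun hP.isIdempotentElem x
  have h2 := hP.isSelfAdjoint.isSymmetric x (P x)
  simp only [ContinuousLinearMap.coe_coe] at h2
  rw [← h1, ← h2, h1, inner_self_eq_norm_sq_to_K]
  simp

/-- For `Im z > 0` and `Im w ≤ 0` the operator `T + w P - z` is strictly dissipative, hence
invertible, and `Im ⟨φ, x⟩` is explicit for `x = (T + w P - z)⁻¹ φ`. -/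
theorem cplxResolvent_spec [CompleteSpace H] {T : H →ₗ.[ℂ] H} (hT : T.IsFormalAdjoint T)
    (hc : HasCompactResolvent T) {P : H →L[ℂ] H} (hP : IsStarProjection P) {z w : ℂ}
    (hz : 0 < z.im) (hw : w.im ≤ 0) :
    IsUnit (1 + w • (P * resolvent T z)) ∧ ∀ φ : H,
      (inner ℂ φ (cplxResolvent T P z w φ)).im =
        z.im * ‖cplxResolvent T P z w φ‖ ^ 2 - w.im * ‖P (cplxResolvent T P z w φ)‖ ^ 2 := by
  have him (x : T.domain) (y : H) (h : (w • P) x + T x - z • (x : H) = y) :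
      (inner ℂ y (x : H)).im = z.im * ‖(x : H)‖ ^ 2 - w.im * ‖P x‖ ^ 2 := by
    have h' : T x - z • (x : H) = y - w • P x := by
      rw [← h, smul_apply]; abel
    have h2 := inner_im_of_apply_sub_smul hT x h'
    have h3 : inner ℂ (P x) (x : H) = ((‖P x‖ ^ 2 : ℝ) : ℂ) := by
      rw [← inner_conj_symm, inner_apply_self_of_isStarProjection hP, Complex.conj_ofReal]
    rw [inner_sub_left, inner_smul_left, h3, Complex.sub_im, Complex.im_mul_ofReal,
      Complex.conj_im] at h2
    linarith
  have hm := mem_resolventSet_of_im_ne_zero hT hc hz.ne'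
  have h := (isResolventAt_resolvent hm).vadd (hc.isCompactOperator_resolvent hm) (w • P) z
    (fun x hx ↦ by
      have h0 := him x 0 (by rw [hx, sub_self])
      rw [inner_zero_left, Complex.zero_im] at h0
      have h1 : 0 ≤ -w.im * ‖P x‖ ^ 2 := mul_nonneg (by linarith) (by positivity)
      have h2 : 0 ≤ z.im * ‖(x : H)‖ ^ 2 := by positivity
      have h3 : z.im * ‖(x : H)‖ ^ 2 = 0 := by linarith
      simpa [hz.ne'] using h3)
  simp only [sub_self, zero_smul, sub_zero, smul_mul_assoc] at h
  refine ⟨h.1, fun φ ↦ ?_⟩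
  obtain ⟨hd, he⟩ := h.2.1 φ
  exact him ⟨_, hd⟩ φ he

theorem differentiableAt_inner_cplxResolvent [CompleteSpace H] {T : H →ₗ.[ℂ] H}
    (hT : T.IsFormalAdjoint T) (hc : HasCompactResolvent T) {P : H →L[ℂ] H}
    (hP : IsStarProjection P) {z w : ℂ} (hz : 0 < z.im) (hw : w.im ≤ 0) (φ : H) :
    DifferentiableAt ℂ (fun w ↦ inner ℂ φ (cplxResolvent T P z w φ)) w := by
  have hu := (cplxResolvent_spec hT hc hP hz hw).1
  have h1 : DifferentiableAt ℂ (fun w ↦ Ring.inverse (1 + w • (P * resolvent T z))) w :=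
    DifferentiableAt.comp (g := Ring.inverse) w
      (differentiableAt_inverse (𝕜 := ℂ) hu) (by fun_prop)
  have h2 : DifferentiableAt ℂ (fun w ↦ cplxResolvent T P z w) w := h1.const_mul _
  exact (innerSL ℂ φ).differentiableAt.comp w (h2.clm_apply (differentiableAt_const φ))

/-- Dissipativity gives `R ‖P x‖² ≤ Im ⟨φ, x⟩ ≤ ‖P x‖` for `x = (T - i R P - z)⁻¹ φ`, hence decay
like `1 / R` along the imaginary axis. -/
theorem inner_cplxResolvent_neg_mul_I_im_le [CompleteSpace H] {T : H →ₗ.[ℂ] H}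
    (hT : T.IsFormalAdjoint T) (hc : HasCompactResolvent T) {P : H →L[ℂ] H}
    (hP : IsStarProjection P) {z : ℂ} (hz : 0 < z.im) {φ : H} (hφ : P φ = φ) (hφ1 : ‖φ‖ ≤ 1)
    {R : ℝ} (hR : 0 < R) :
    (inner ℂ φ (cplxResolvent T P z (-(R * Complex.I)) φ)).im ≤ 1 / R := by
  have h := (cplxResolvent_spec hT hc hP hz (w := -(R * Complex.I)) (by simp; exact hR.le)).2 φ
  set x := cplxResolvent T P z (-(R * Complex.I)) φ
  have h1 : inner ℂ φ x = inner ℂ φ (P x) := by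
    have := hP.isSelfAdjoint.isSymmetric φ x
    simpa only [ContinuousLinearMap.coe_coe, hφ] using this
  have h2 : (inner ℂ φ x).im ≤ ‖P x‖ := by
    calc (inner ℂ φ x).im ≤ ‖inner ℂ φ x‖ := (le_abs_self _).trans (Complex.abs_im_le_norm _)
      _ ≤ ‖φ‖ * ‖P x‖ := by rw [h1]; exact norm_inner_le_norm _ _
      _ ≤ 1 * ‖P x‖ := by gcongr
      _ = ‖P x‖ := one_mul _
  have h3 : R * ‖P x‖ ^ 2 ≤ (inner ℂ φ x).im := by
    rw [h]
    simp only [Complex.neg_im, Complex.im_ofReal_mul, Complex.I_im, mul_one, neg_mul,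
      sub_neg_eq_add]
    have : 0 ≤ z.im * ‖x‖ ^ 2 := by positivity
    linarith
  refine h2.trans ?_
  rw [le_div_iff₀ hR]
  rcases (norm_nonneg (P x)).eq_or_lt with h0 | h0
  · rw [← h0]; simp
  · nlinarith

/-- The Cayley transform `ζ ↦ -i R (1 + ζ) / (1 - ζ)` of the unit disc onto the lower half-plane. -/
noncomputable def cayley (R : ℝ) (ζ : ℂ) : ℂ := -(R * Complex.I) * ((1 + ζ) / (1 - ζ))

theorem cayley_im (R : ℝ) (ζ : ℂ) : (cayley R ζ).im = -R * ((1 - ‖ζ‖ ^ 2) / ‖1 - ζ‖ ^ 2) := by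
  have h : (1 + ζ) / (1 - ζ) = (1 + ζ) * (starRingEnd ℂ) (1 - ζ) / ((‖1 - ζ‖ ^ 2 : ℝ) : ℂ) := by
    rcases eq_or_ne (1 - ζ) 0 with h0 | h0
    · simp [h0]
    · rw [div_eq_div_iff h0 (by simpa using h0), mul_assoc, Complex.conj_mul', Complex.ofReal_pow]
  have h2 : (cayley R ζ).im = -R * ((1 + ζ) / (1 - ζ)).re := by
    simp [cayley]
  rw [h2, h, Complex.div_ofReal_re, Complex.sq_norm ζ, Complex.normSq_apply]
  simp
  left
  ring

/-- The boundary parametrisation of the Cayley transform by the angle `π - 2 arctan (u / R)`. -/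
theorem cayley_exp {R : ℝ} (hR : 0 < R) (u : ℝ) :
    Complex.exp (((Real.pi - 2 * Real.arctan (u / R) : ℝ) : ℂ) * Complex.I) ≠ 1 ∧
      cayley R (Complex.exp (((Real.pi - 2 * Real.arctan (u / R) : ℝ) : ℂ) * Complex.I)) = u := by
  set x := u / R with hx
  set a := Real.arctan x with ha
  set ζ := Complex.exp (((Real.pi - 2 * a : ℝ) : ℂ) * Complex.I) with hζ
  have hne : (1 : ℂ) + x * Complex.I ≠ 0 := fun h ↦ by simpa using congrArg Complex.re h
  have hexp : Complex.exp (-(a : ℂ) * Complex.I) =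
      (1 - x * Complex.I) / ((√(1 + x ^ 2) : ℝ) : ℂ) := by
    rw [Complex.exp_mul_I, Complex.cos_neg, Complex.sin_neg, ← Complex.ofReal_cos,
      ← Complex.ofReal_sin, ha, Real.cos_arctan, Real.sin_arctan]
    push_cast
    ring
  have hsq : (((√(1 + x ^ 2) : ℝ) : ℂ)) ^ 2 = (1 - x * Complex.I) * (1 + x * Complex.I) := by
    rw [← Complex.ofReal_pow, Real.sq_sqrt (by positivity)]
    push_cast
    linear_combination (x : ℂ) ^ 2 * Complex.I_sq
  have hne' : (1 : ℂ) - x * Complex.I ≠ 0 := fun h ↦ by simpa using congrArg Complex.re h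
  have hζ' : ζ = -((1 - x * Complex.I) / (1 + x * Complex.I)) := by
    have : ((Real.pi - 2 * a : ℝ) : ℂ) * Complex.I =
        Real.pi * Complex.I + (2 : ℕ) * (-(a : ℂ) * Complex.I) := by push_cast; ring
    rw [hζ, this, Complex.exp_add, Complex.exp_pi_mul_I, Complex.exp_nat_mul, hexp, div_pow, hsq]
    field_simp
  have h1 : 1 - ζ = 2 / (1 + x * Complex.I) := by rw [hζ']; field_simp; ring
  have h2 : 1 + ζ = 2 * x * Complex.I / (1 + x * Complex.I) := by rw [hζ']; field_simp; ring
  constructor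
  · intro h
    rw [h, sub_self] at h1
    exact div_ne_zero two_ne_zero hne h1.symm
  · rw [cayley, h1, h2]
    have hRc : (R : ℂ) ≠ 0 := by exact_mod_cast hR.ne'
    have : (u : ℂ) = R * x := by rw [hx]; push_cast; field_simp
    rw [this, div_div_div_cancel_right₀ hne]
    linear_combination -(R : ℂ) * x * Complex.I_sq

/-- Poisson's inequality in the lower half-plane: the mean value property on the circles `|ζ| = r`
in the Cayley variable, followed by Fatou's lemma as `r → 1`. -/
theorem lintegral_poisson_le {F : ℂ → ℂ} (hF : ∀ w : ℂ, w.im ≤ 0 → DifferentiableAt ℂ F w)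
    (hF0 : ∀ w : ℂ, w.im ≤ 0 → 0 ≤ (F w).im) {R : ℝ} (hR : 0 < R) :
    ∫⁻ u : ℝ, ENNReal.ofReal (2 * R / (R ^ 2 + u ^ 2)) * ENNReal.ofReal (F u).im ≤
      ENNReal.ofReal (2 * Real.pi * (F (-(R * Complex.I))).im) := by
  set G : ℂ → ℂ := fun ζ ↦ F (cayley R ζ) with hG
  have hcay {ζ : ℂ} (hζ : ‖ζ‖ ≤ 1) : (cayley R ζ).im ≤ 0 := by
    rw [cayley_im, neg_mul]
    exact neg_nonpos.mpr (mul_nonneg hR.le (div_nonneg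
      (sub_nonneg.mpr (pow_le_one₀ (norm_nonneg _) hζ)) (by positivity)))
  have hGd {ζ : ℂ} (hζ : ‖ζ‖ ≤ 1) (hζ1 : ζ ≠ 1) : DifferentiableAt ℂ G ζ := by
    refine (hF _ (hcay hζ)).comp ζ (f := cayley R) ?_
    unfold cayley
    have : 1 - ζ ≠ 0 := sub_ne_zero.mpr hζ1.symm
    fun_prop (disch := assumption)
  let r : ℕ → ℝ := fun n ↦ 1 - 1 / ((n : ℝ) + 1)
  have hr0 (n : ℕ) : 0 ≤ r n := by
    have : 1 / ((n : ℝ) + 1) ≤ 1 := by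
      rw [div_le_one (by positivity)]; linarith [n.cast_nonneg (α := ℝ)]
    simp only [r]; linarith
  have hr1 (n : ℕ) : r n < 1 := by
    have : 0 < 1 / ((n : ℝ) + 1) := by positivity
    simp only [r]; linarith
  have hrlim : Filter.Tendsto r Filter.atTop (nhds 1) := by
    simpa [r] using tendsto_one_div_add_atTop_nhds_zero_nat.const_sub (1 : ℝ)
  have hnorm (n : ℕ) (θ : ℝ) : ‖circleMap 0 (r n) θ‖ = r n := by
    rw [norm_circleMap_zero, abs_of_nonneg (hr0 n)]
  have hne1 {ζ : ℂ} (h : ‖ζ‖ < 1) : ζ ≠ 1 := by rintro rfl; simp at h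
  have hcont (n : ℕ) : Continuous fun θ : ℝ ↦ G (circleMap 0 (r n) θ) := by
    refine continuous_iff_continuousAt.mpr fun θ ↦ ?_
    have hlt : ‖circleMap 0 (r n) θ‖ < 1 := by rw [hnorm]; exact hr1 n
    exact ContinuousAt.comp (f := circleMap 0 (r n)) (hGd hlt.le (hne1 hlt)).continuousAt
      (continuous_circleMap 0 (r n)).continuousAt
  -- the centre `ζ = 0` of the circles corresponds to the point `-i R`
  have hmean (n : ℕ) : ∫⁻ θ in Set.Ioc 0 (2 * Real.pi),
      ENNReal.ofReal (G (circleMap 0 (r n) θ)).im =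
      ENNReal.ofReal (2 * Real.pi * (F (-(R * Complex.I))).im) := by
    have hd : DiffContOnCl ℂ G (Metric.ball 0 |r n|) := by
      refine DifferentiableOn.diffContOnCl fun ζ hζ ↦ ?_
      have hζ' := Metric.closure_ball_subset_closedBall hζ
      rw [mem_closedBall_zero_iff, abs_of_nonneg (hr0 n)] at hζ'
      have hlt := hζ'.trans_lt (hr1 n)
      exact (hGd hlt.le (hne1 hlt)).differentiableWithinAt
    have h1 := hd.circleAverage
    have hG0 : G 0 = F (-(R * Complex.I)) := by simp [hG, cayley]
    rw [Real.circleAverage_def, hG0, inv_smul_eq_iff₀ (by positivity)] at h1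
    have h2 := congrArg Complex.im h1
    have h3 := Complex.imCLM.intervalIntegral_comp_comm
      ((hcont n).intervalIntegrable (μ := volume) 0 (2 * Real.pi))
    rw [Complex.imCLM_apply, h2, intervalIntegral.integral_of_le (by positivity)] at h3
    simp only [Complex.imCLM_apply, Complex.real_smul, Complex.im_ofReal_mul] at h3
    rw [← h3, ofReal_integral_eq_lintegral_ofReal]
    · have := (Complex.continuous_im.comp (hcont n)).intervalIntegrable (μ := volume)
        0 (2 * Real.pi)
      exact (intervalIntegrable_iff_integrableOn_Ioc_of_le (by positivity)).mp this
    · exact .of_forall fun θ ↦ hF0 _ (hcay ((hnorm n θ).trans_le (hr1 n).le))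
  set g : ℝ → ℝ≥0∞ := fun θ ↦ Filter.liminf
    (fun n ↦ ENNReal.ofReal (G (circleMap 0 (r n) θ)).im) Filter.atTop with hg
  have hfatou : ∫⁻ θ in Set.Ioc 0 (2 * Real.pi), g θ ≤
      ENNReal.ofReal (2 * Real.pi * (F (-(R * Complex.I))).im) := by
    refine (lintegral_liminf_le fun n ↦ ?_).trans (by simp_rw [hmean]; simp)
    exact (Complex.continuous_im.comp (hcont n)).measurable.ennreal_ofReal
  -- the boundary angle of the real point `u`; its range lies in `(0, 2π)`
  set θ : ℝ → ℝ := fun u ↦ Real.pi - 2 * Real.arctan (u / R) with hθ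
  have hgθ (u : ℝ) : g (θ u) = ENNReal.ofReal (F u).im := by
    obtain ⟨h1, h2⟩ := cayley_exp hR u
    refine Filter.Tendsto.liminf_eq ?_
    refine (ENNReal.continuous_ofReal.tendsto _).comp ((Complex.continuous_im.tendsto _).comp ?_)
    rw [show F u = G (Complex.exp ((θ u : ℂ) * Complex.I)) by simp only [hG, hθ, h2]]
    have hexp1 : ‖Complex.exp ((θ u : ℂ) * Complex.I)‖ ≤ 1 :=
      (Complex.norm_exp_ofReal_mul_I _).le
    refine (hGd hexp1 h1).continuousAt.tendsto.comp ?_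
    have h3 := (Complex.continuous_ofReal.tendsto _).comp hrlim
    have h4 := h3.mul_const (Complex.exp ((θ u : ℂ) * Complex.I))
    simp only [Complex.ofReal_one, one_mul] at h4
    refine h4.congr fun n ↦ ?_
    simp [circleMap]
  have hderiv (u : ℝ) : HasDerivAt θ (-(2 * R / (R ^ 2 + u ^ 2))) u := by
    have h1 := (((hasDerivAt_id u).div_const R).arctan.const_mul 2).const_sub Real.pi
    convert! h1 using 1
    simp only [id]
    field_simp
  have hinj : Function.Injective θ := by
    intro u v h
    have h1 : Real.arctan (u / R) = Real.arctan (v / R) := by simp only [hθ] at h; linarith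
    exact (div_left_inj' hR.ne').mp (Real.arctan_injective h1)
  have hchange := lintegral_image_eq_lintegral_abs_deriv_mul MeasurableSet.univ
    (fun u _ ↦ (hderiv u).hasDerivWithinAt) hinj.injOn g
  rw [Measure.restrict_univ] at hchange
  calc ∫⁻ u : ℝ, ENNReal.ofReal (2 * R / (R ^ 2 + u ^ 2)) * ENNReal.ofReal (F u).im
      = ∫⁻ u : ℝ, ENNReal.ofReal |-(2 * R / (R ^ 2 + u ^ 2))| * g (θ u) := by
        refine lintegral_congr fun u ↦ ?_
        rw [hgθ, abs_neg, abs_of_nonneg (by positivity)]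
    _ = ∫⁻ t in θ '' Set.univ, g t := hchange.symm
    _ ≤ ∫⁻ t in Set.Ioc 0 (2 * Real.pi), g t := by
        refine lintegral_mono_set ?_
        rintro _ ⟨u, -, rfl⟩
        have h1 := Real.arctan_lt_pi_div_two (u / R)
        have h2 := Real.neg_pi_div_two_lt_arctan (u / R)
        constructor <;> simp only [hθ] <;> linarith
    _ ≤ _ := hfatou

/-- Averaged over the coupling `u`, the imaginary part of the resolvent of `T + u P` at a vector of
the range of `P` has total mass at most `π`. -/
theorem lintegral_enorm_resolvent_perturbed_sq_le [CompleteSpace H] {T : H →ₗ.[ℂ] H}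
    (hT : T.IsFormalAdjoint T) (hc : HasCompactResolvent T) {P : H →L[ℂ] H}
    (hP : IsStarProjection P) {z : ℂ} (hz : 0 < z.im) {φ : H} (hφ : P φ = φ) (hφ1 : ‖φ‖ ≤ 1) :
    ∫⁻ u : ℝ, ENNReal.ofReal (z.im * ‖resolvent (perturbed T P u) z φ‖ ^ 2) ≤
      ENNReal.ofReal Real.pi := by
  set F : ℂ → ℂ := fun w ↦ inner ℂ φ (cplxResolvent T P z w φ) with hF
  have hFd (w : ℂ) (hw : w.im ≤ 0) : DifferentiableAt ℂ F w :=
    differentiableAt_inner_cplxResolvent hT hc hP hz hw φ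
  have hF0 (w : ℂ) (hw : w.im ≤ 0) : 0 ≤ (F w).im := by
    rw [hF, (cplxResolvent_spec hT hc hP hz hw).2]
    have : 0 ≤ -w.im * ‖P (cplxResolvent T P z w φ)‖ ^ 2 :=
      mul_nonneg (by linarith) (by positivity)
    have : 0 ≤ z.im * ‖cplxResolvent T P z w φ‖ ^ 2 := by positivity
    linarith
  have hFu (u : ℝ) : (F u).im = z.im * ‖resolvent (perturbed T P u) z φ‖ ^ 2 := by
    rw [hF, (cplxResolvent_spec hT hc hP hz (by simp)).2,
      (isResolventAt_perturbed hT hc hP.isSelfAdjoint u hz.ne').2.resolvent_eq]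
    simp [cplxResolvent]
  simp_rw [← hFu]
  have hFm : Measurable fun u : ℝ ↦ ENNReal.ofReal (F u).im := by
    refine (Complex.continuous_im.comp (continuous_iff_continuousAt.mpr
      fun u ↦ ?_)).measurable.ennreal_ofReal
    exact ContinuousAt.comp (f := ((↑) : ℝ → ℂ)) (hFd u (by simp)).continuousAt
      Complex.continuous_ofReal.continuousAt
  have hbound (n : ℕ) : ∫⁻ u : ℝ, ENNReal.ofReal
      (((n : ℝ) + 1) ^ 2 / (((n : ℝ) + 1) ^ 2 + u ^ 2)) * ENNReal.ofReal (F u).im ≤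
        ENNReal.ofReal Real.pi := by
    set R : ℝ := (n : ℝ) + 1 with hR'
    have hR : 0 < R := by positivity
    have h1 := (lintegral_poisson_le hFd hF0 hR).trans (ENNReal.ofReal_le_ofReal
      (mul_le_mul_of_nonneg_left (inner_cplxResolvent_neg_mul_I_im_le hT hc hP hz hφ hφ1 hR)
        (by positivity)))
    have h2 := mul_le_mul_right h1 (ENNReal.ofReal (R / 2))
    rw [← lintegral_const_mul' _ _ ENNReal.ofReal_ne_top,
      ← ENNReal.ofReal_mul (by positivity)] at h2
    convert! h2 using 1
    · refine lintegral_congr fun u ↦ ?_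
      have e : R ^ 2 / (R ^ 2 + u ^ 2) = R / 2 * (2 * R / (R ^ 2 + u ^ 2)) := by field_simp
      rw [e, ENNReal.ofReal_mul (by positivity), mul_assoc]
    · congr 1
      field_simp
  have hlim (u : ℝ) : Filter.Tendsto (fun n : ℕ ↦ ENNReal.ofReal
      (((n : ℝ) + 1) ^ 2 / (((n : ℝ) + 1) ^ 2 + u ^ 2)) * ENNReal.ofReal (F u).im)
      Filter.atTop (nhds (ENNReal.ofReal (F u).im)) := by
    have h0 : Filter.Tendsto (fun n : ℕ ↦ (1 + (u * (1 / ((n : ℝ) + 1))) ^ 2)⁻¹) Filter.atTop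
        (nhds 1) := by
      simpa using (((tendsto_one_div_add_atTop_nhds_zero_nat.const_mul u).pow 2).const_add
        (1 : ℝ)).inv₀ (by simp)
    have h1 : Filter.Tendsto (fun n : ℕ ↦ ((n : ℝ) + 1) ^ 2 / (((n : ℝ) + 1) ^ 2 + u ^ 2))
        Filter.atTop (nhds 1) := by
      refine h0.congr fun n ↦ ?_
      field_simp
    have h2 := (ENNReal.continuous_ofReal.tendsto _).comp h1
    rw [ENNReal.ofReal_one] at h2
    simpa using ENNReal.Tendsto.mul_const h2 (Or.inl one_ne_zero)
  calc ∫⁻ u : ℝ, ENNReal.ofReal (F u).im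
      = ∫⁻ u : ℝ, Filter.liminf (fun n : ℕ ↦ ENNReal.ofReal
          (((n : ℝ) + 1) ^ 2 / (((n : ℝ) + 1) ^ 2 + u ^ 2)) * ENNReal.ofReal (F u).im)
          Filter.atTop := lintegral_congr fun u ↦ (hlim u).liminf_eq.symm
    _ ≤ Filter.liminf (fun n : ℕ ↦ ∫⁻ u : ℝ, ENNReal.ofReal
          (((n : ℝ) + 1) ^ 2 / (((n : ℝ) + 1) ^ 2 + u ^ 2)) * ENNReal.ofReal (F u).im)
          Filter.atTop := lintegral_liminf_le fun n ↦ by fun_prop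
    _ ≤ ENNReal.ofReal Real.pi := Filter.liminf_le_of_frequently_le'
          (Filter.Frequently.of_forall hbound)

/-! ### Spectral averaging -/

theorem setLIntegral_lorentz (E : ℝ) {ε : ℝ} (hε : 0 < ε) {a b : ℝ} (hab : a ≤ b) :
    ∫⁻ x in Set.Ioo a b, ENNReal.ofReal (ε / ((E - x) ^ 2 + ε ^ 2)) =
      ENNReal.ofReal (Real.arctan ((b - E) / ε) - Real.arctan ((a - E) / ε)) := by
  have hcont : Continuous fun x : ℝ ↦ ε / ((E - x) ^ 2 + ε ^ 2) :=
    continuous_const.div (by fun_prop) fun x ↦ by positivity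
  have hderiv (x : ℝ) : HasDerivAt (fun x ↦ Real.arctan ((x - E) / ε))
      (ε / ((E - x) ^ 2 + ε ^ 2)) x := by
    have h1 := (((hasDerivAt_id x).sub_const E).div_const ε).arctan
    convert! h1 using 1
    simp only [id]
    field_simp
    ring
  have hint := intervalIntegral.integral_eq_sub_of_hasDerivAt (a := a) (b := b)
    (fun x _ ↦ hderiv x) (hcont.intervalIntegrable a b)
  rw [← hint, intervalIntegral.integral_of_le hab, setLIntegral_congr Ioo_ae_eq_Ioc,
    ofReal_integral_eq_lintegral_ofReal]
  · exact (intervalIntegrable_iff_integrableOn_Ioc_of_le hab).mp (hcont.intervalIntegrable a b)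
  · exact .of_forall fun x ↦ by positivity

/-- Lebesgue outer measure is an infimum over covers by intervals, so domination on open intervals
suffices. -/
theorem le_volume_of_Ioo {ν : Measure ℝ}
    (h : ∀ a b : ℝ, a ≤ b → ν (Set.Ioo a b) ≤ ENNReal.ofReal (b - a)) : ν ≤ volume := by
  have hIoc (a b : ℝ) : ν (Set.Ioc a b) ≤ ENNReal.ofReal (b - a) := by
    rcases lt_or_ge b a with hab | hab
    · simp [Set.Ioc_eq_empty hab.not_gt]
    · refine ENNReal.le_of_forall_pos_le_add fun ε hε _ ↦ ?_
      calc ν (Set.Ioc a b) ≤ ν (Set.Ioo a (b + ε)) :=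
            measure_mono fun x hx ↦ ⟨hx.1, by
              have := hx.2; have : (0 : ℝ) < ε := hε; linarith⟩
        _ ≤ ENNReal.ofReal (b + ε - a) := h _ _ (by have : (0 : ℝ) < ε := hε; linarith)
        _ = ENNReal.ofReal (b - a) + ε := by
            rw [show b + ε - a = (b - a) + ε by ring,
              ENNReal.ofReal_add (by linarith) ε.coe_nonneg, ENNReal.ofReal_coe_nnreal]
  have hout : ν.toOuterMeasure ≤ StieltjesFunction.id.outer := by
    refine OuterMeasure.le_ofFunction.mpr fun s ↦ ?_
    rw [StieltjesFunction.length_eq]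
    refine le_iInf fun a ↦ le_iInf fun b ↦ le_iInf fun hs ↦ ?_
    have hs' : s ⊆ Set.Ioc a b := by simpa [botSet] using hs
    exact (measure_mono hs').trans (hIoc a b)
  refine Measure.le_iff'.mpr fun s ↦ ?_
  rw [Real.volume_eq_stieltjes_id, StieltjesFunction.measure]
  exact hout s

/-- The imaginary part of the resolvent at a vector is the Poisson integral of its spectral
measure. -/
theorem ofReal_mul_norm_resolvent_sq [CompleteSpace H] [TopologicalSpace.SeparableSpace H]
    {T : H →ₗ.[ℂ] H} (hT : T.IsFormalAdjoint T) (hc : HasCompactResolvent T) (φ : H) (x : ℝ)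
    {ε : ℝ} (hε : 0 < ε) :
    ENNReal.ofReal (ε * ‖resolvent T (x + ε * Complex.I) φ‖ ^ 2) =
      ∫⁻ E, ENNReal.ofReal (ε / ((E - x) ^ 2 + ε ^ 2)) ∂specMeasure T φ := by
  have him : ((x : ℂ) + ε * Complex.I).im ≠ 0 := by simp [hε.ne']
  rw [ENNReal.ofReal_mul hε.le, ENNReal.ofReal_pow (norm_nonneg _), ofReal_norm,
    ← tsum_enorm_spectralProj_sq hT hc, lintegral_specMeasure, ← ENNReal.tsum_mul_left]
  refine tsum_congr fun E ↦ ?_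
  have hne : (E : ℂ) - (x + ε * Complex.I) ≠ 0 := fun h ↦ by
    simpa [hε.ne'] using congrArg Complex.im h
  rw [spectralProj_singleton_resolvent hT hc hne
    (isResolventAt_resolvent (mem_resolventSet_of_im_ne_zero hT hc him)), enorm_smul, mul_pow,
    ← mul_assoc, mul_comm _ (‖spectralProj T {E} φ‖ₑ ^ 2)]
  congr 1
  rw [← ofReal_norm, ← ENNReal.ofReal_pow (norm_nonneg _), ← ENNReal.ofReal_mul hε.le, norm_inv,
    inv_pow, Complex.sq_norm, Complex.normSq_apply]
  congr 1
  simp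
  field_simp

/-- **Spectral averaging.** For a vector of norm at most one in the range of `P`, the spectral
measures of `T + u P` integrate over `u` to a measure dominated by Lebesgue measure. -/
theorem bind_specMeasure_le_volume [CompleteSpace H] [TopologicalSpace.SeparableSpace H]
    {T : H →ₗ.[ℂ] H} (hT : T.IsFormalAdjoint T) (hc : HasCompactResolvent T) {P : H →L[ℂ] H}
    (hP : IsStarProjection P) {φ : H} (hφ : P φ = φ) (hφ1 : ‖φ‖ ≤ 1) :
    (volume.bind fun u : ℝ ↦ specMeasure (perturbed T P u) φ) ≤ volume := by
  have hmeas := measurable_specMeasure_perturbed hT hc hP.isSelfAdjoint φ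
  have hTu (u : ℝ) := isFormalAdjoint_perturbed hT hP.isSelfAdjoint u
  have hcu (u : ℝ) := hasCompactResolvent_perturbed hT hc hP.isSelfAdjoint u
  let κ : ProbabilityTheory.Kernel ℝ ℝ := ⟨_, hmeas⟩
  have : ProbabilityTheory.IsFiniteKernel κ := ⟨‖φ‖ₑ ^ 2, ENNReal.pow_lt_top enorm_lt_top,
    fun p ↦ (specMeasure_univ (hTu p) (hcu p) φ).le⟩
  set ν : Measure ℝ := volume.bind fun u : ℝ ↦ specMeasure (perturbed T P u) φ with hν
  have : SFinite ν := inferInstanceAs (SFinite (volume.bind κ))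
  have hpoint (x : ℝ) {ε : ℝ} (hε : 0 < ε) :
      ∫⁻ E, ENNReal.ofReal (ε / ((E - x) ^ 2 + ε ^ 2)) ∂ν ≤ ENNReal.ofReal Real.pi := by
    rw [hν, Measure.lintegral_bind hmeas.aemeasurable (by fun_prop)]
    have h := lintegral_enorm_resolvent_perturbed_sq_le hT hc hP
      (z := x + ε * Complex.I) (by simpa using hε) hφ hφ1
    simp_rw [← fun u ↦ ofReal_mul_norm_resolvent_sq (hTu u) (hcu u) φ x hε]
    simpa using h
  refine le_volume_of_Ioo fun a b hab ↦ ?_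
  have hint {ε : ℝ} (hε : 0 < ε) :
      ∫⁻ E, ENNReal.ofReal (Real.arctan ((b - E) / ε) - Real.arctan ((a - E) / ε)) ∂ν ≤
        ENNReal.ofReal Real.pi * ENNReal.ofReal (b - a) := by
    simp_rw [← fun E ↦ setLIntegral_lorentz E hε hab]
    rw [lintegral_lintegral_swap (by fun_prop)]
    refine (lintegral_mono fun x ↦ hpoint x hε).trans ?_
    simp
  -- as `ε → 0` the Poisson kernel integrated over `(a, b)` tends to `π` at interior points
  have hlim (E : ℝ) : (Set.Ioo a b).indicator (fun _ ↦ ENNReal.ofReal Real.pi) E ≤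
      Filter.liminf (fun n : ℕ ↦ ENNReal.ofReal (Real.arctan ((b - E) / (1 / ((n : ℝ) + 1))) -
        Real.arctan ((a - E) / (1 / ((n : ℝ) + 1))))) Filter.atTop := by
    by_cases hE : E ∈ Set.Ioo a b
    · rw [Set.indicator_of_mem hE]
      have hn : Filter.Tendsto (fun n : ℕ ↦ (n : ℝ) + 1) Filter.atTop Filter.atTop :=
        Filter.tendsto_atTop_add_const_right _ _ tendsto_natCast_atTop_atTop
      have h1 : Filter.Tendsto (fun n : ℕ ↦ (b - E) / (1 / ((n : ℝ) + 1))) Filter.atTop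
          Filter.atTop := by
        simpa using hn.const_mul_atTop (sub_pos.mpr hE.2)
      have h2 : Filter.Tendsto (fun n : ℕ ↦ (a - E) / (1 / ((n : ℝ) + 1))) Filter.atTop
          Filter.atBot := by
        simpa using hn.const_mul_atTop_of_neg (sub_neg.mpr hE.1)
      have h3 := (Real.tendsto_arctan_atTop.mono_right nhdsWithin_le_nhds).comp h1
      have h4 := (Real.tendsto_arctan_atBot.mono_right nhdsWithin_le_nhds).comp h2
      have h5 := (ENNReal.continuous_ofReal.tendsto _).comp (h3.sub h4)
      rw [show Real.pi / 2 - -(Real.pi / 2) = Real.pi by ring] at h5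
      exact h5.liminf_eq.ge
    · rw [Set.indicator_of_notMem hE]
      exact zero_le
  have hmain : ENNReal.ofReal Real.pi * ν (Set.Ioo a b) ≤
      ENNReal.ofReal Real.pi * ENNReal.ofReal (b - a) := by
    rw [← lintegral_indicator_const measurableSet_Ioo]
    calc _ ≤ ∫⁻ E, Filter.liminf (fun n : ℕ ↦
            ENNReal.ofReal (Real.arctan ((b - E) / (1 / ((n : ℝ) + 1))) -
            Real.arctan ((a - E) / (1 / ((n : ℝ) + 1))))) Filter.atTop ∂ν := lintegral_mono hlim
      _ ≤ Filter.liminf (fun n : ℕ ↦ ∫⁻ E,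
            ENNReal.ofReal (Real.arctan ((b - E) / (1 / ((n : ℝ) + 1))) -
            Real.arctan ((a - E) / (1 / ((n : ℝ) + 1)))) ∂ν) Filter.atTop :=
          lintegral_liminf_le fun n ↦ by fun_prop
      _ ≤ _ := Filter.liminf_le_of_frequently_le'
          (Filter.Frequently.of_forall fun n ↦ hint (by positivity))
  exact (ENNReal.mul_le_mul_iff_right (by simp [Real.pi_pos]) ENNReal.ofReal_ne_top).mp hmain

theorem lintegral_lintegral_specMeasure_le [CompleteSpace H] [TopologicalSpace.SeparableSpace H]
    {T : H →ₗ.[ℂ] H} (hT : T.IsFormalAdjoint T) (hc : HasCompactResolvent T) {P : H →L[ℂ] H}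
    (hP : IsStarProjection P) {φ : H} (hφ : P φ = φ) (hφ1 : ‖φ‖ ≤ 1) {f : ℝ → ℝ≥0∞}
    (hf : Measurable f) :
    ∫⁻ u : ℝ, ∫⁻ E, f E ∂specMeasure (perturbed T P u) φ ≤ ∫⁻ E, f E := by
  rw [← Measure.lintegral_bind
    (measurable_specMeasure_perturbed hT hc hP.isSelfAdjoint φ).aemeasurable hf.aemeasurable]
  exact lintegral_mono' (bind_specMeasure_le_volume hT hc hP hφ hφ1) le_rfl

/-- Spectral averaging for a simple function with values in the unit ball of the range of `P`. -/
theorem lintegral_tsum_simpleFunc_le [CompleteSpace H] [TopologicalSpace.SeparableSpace H]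
    {T : H →ₗ.[ℂ] H} (hT : T.IsFormalAdjoint T) (hc : HasCompactResolvent T) {P : H →L[ℂ] H}
    (hP : IsStarProjection P) {w : ℝ → ℝ≥0∞} (hw : Measurable w) (g : SimpleFunc ℝ H)
    (hg : ∀ E, P (g E) = g E ∧ ‖g E‖ ≤ 1) :
    Measurable (fun u : ℝ ↦ ∑' E, ‖spectralProj (perturbed T P u) {E} (g E)‖ₑ ^ 2 * w E) ∧
      ∫⁻ u : ℝ, ∑' E, ‖spectralProj (perturbed T P u) {E} (g E)‖ₑ ^ 2 * w E ≤ ∫⁻ E, w E := by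
  have hmeas (y : H) : Measurable ((g ⁻¹' {y}).indicator w) :=
    hw.indicator (g.measurableSet_fiber y)
  -- on each fibre of `g` the vector is constant, so the sum is an integral of a spectral measure
  have hdecomp (u : ℝ) : ∑' E, ‖spectralProj (perturbed T P u) {E} (g E)‖ₑ ^ 2 * w E =
      ∑ y ∈ g.range, ∫⁻ E, (g ⁻¹' {y}).indicator w E ∂specMeasure (perturbed T P u) y := by
    simp_rw [lintegral_specMeasure]
    rw [← Summable.tsum_finsetSum fun _ _ ↦ ENNReal.summable]
    refine tsum_congr fun E ↦ ?_
    rw [Finset.sum_eq_single (g E) (fun y _ hy ↦ by simp [Set.indicator, hy.symm])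
      (fun h ↦ (h (g.mem_range_self E)).elim)]
    simp
  have hm (y : H) : Measurable fun u : ℝ ↦
      ∫⁻ E, (g ⁻¹' {y}).indicator w E ∂specMeasure (perturbed T P u) y :=
    (Measure.measurable_lintegral (hmeas y)).comp
      (measurable_specMeasure_perturbed hT hc hP.isSelfAdjoint y)
  simp_rw [hdecomp]
  refine ⟨Finset.measurable_sum _ fun y _ ↦ hm y, ?_⟩
  rw [lintegral_finsetSum _ fun y _ ↦ hm y]
  calc _ ≤ ∑ y ∈ g.range, ∫⁻ E, (g ⁻¹' {y}).indicator w E := by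
        refine Finset.sum_le_sum fun y hy ↦ ?_
        obtain ⟨E, rfl⟩ := SimpleFunc.mem_range.mp hy
        exact lintegral_lintegral_specMeasure_le hT hc hP (hg E).1 (hg E).2 (hmeas _)
    _ = ∫⁻ E, w E := by
        rw [← lintegral_finsetSum _ fun y _ ↦ hmeas y]
        refine lintegral_congr fun E ↦ ?_
        rw [Finset.sum_eq_single (g E) (fun y _ hy ↦ by simp [Set.indicator, hy.symm])
          (fun h ↦ (h (g.mem_range_self E)).elim)]
        simp

/-- Spectral averaging for an energy-dependent vector in the unit ball of the range of `P`. -/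
theorem lintegral_tsum_le [CompleteSpace H] [TopologicalSpace.SeparableSpace H]
    {T : H →ₗ.[ℂ] H} (hT : T.IsFormalAdjoint T) (hc : HasCompactResolvent T) {P : H →L[ℂ] H}
    (hP : IsStarProjection P) {w : ℝ → ℝ≥0∞} (hw : Measurable w) (hw' : ∀ E, w E ≠ ∞)
    {e : ℝ → H} (he : StronglyMeasurable e) (heP : ∀ E, P (e E) = e E ∧ ‖e E‖ ≤ 1) :
    ∫⁻ u : ℝ, ∑' E, ‖spectralProj (perturbed T P u) {E} (e E)‖ₑ ^ 2 * w E ≤ ∫⁻ E, w E := by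
  borelize H
  have : SecondCountableTopology H := UniformSpace.secondCountable_of_separable H
  let s : Set H := {y | P y = y ∧ ‖y‖ ≤ 1}
  have h0 : (0 : H) ∈ s := by simp [s]
  let g : ℕ → SimpleFunc ℝ H := SimpleFunc.approxOn e he.measurable s 0 h0
  have hg (n : ℕ) (E : ℝ) : P (g n E) = g n E ∧ ‖g n E‖ ≤ 1 :=
    SimpleFunc.approxOn_mem he.measurable h0 n E
  have hlim (E : ℝ) : Filter.Tendsto (fun n ↦ g n E) Filter.atTop (nhds (e E)) :=
    SimpleFunc.tendsto_approxOn he.measurable h0 (subset_closure (heP E))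
  have hfatou (u : ℝ) : ∑' E, ‖spectralProj (perturbed T P u) {E} (e E)‖ₑ ^ 2 * w E ≤
      Filter.liminf (fun n ↦
        ∑' E, ‖spectralProj (perturbed T P u) {E} (g n E)‖ₑ ^ 2 * w E) Filter.atTop := by
    rw [ENNReal.tsum_eq_iSup_sum]
    refine iSup_le fun S ↦ ?_
    have ht : Filter.Tendsto (fun n ↦ ∑ E ∈ S,
        ‖spectralProj (perturbed T P u) {E} (g n E)‖ₑ ^ 2 * w E) Filter.atTop
        (nhds (∑ E ∈ S, ‖spectralProj (perturbed T P u) {E} (e E)‖ₑ ^ 2 * w E)) := by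
      refine tendsto_finsetSum _ fun E _ ↦ ENNReal.Tendsto.mul_const ?_ (Or.inr (hw' E))
      exact ENNReal.Tendsto.pow (continuous_enorm.continuousAt.tendsto.comp
        (((spectralProj (perturbed T P u) {E}).continuous.tendsto _).comp (hlim E)))
    rw [← ht.liminf_eq]
    exact Filter.liminf_le_liminf (.of_forall fun n ↦ ENNReal.sum_le_tsum S)
  have hn (n : ℕ) := lintegral_tsum_simpleFunc_le hT hc hP hw (g n) (hg n)
  calc _ ≤ ∫⁻ u : ℝ, Filter.liminf (fun n ↦
        ∑' E, ‖spectralProj (perturbed T P u) {E} (g n E)‖ₑ ^ 2 * w E) Filter.atTop :=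
        lintegral_mono hfatou
    _ ≤ Filter.liminf (fun n ↦ ∫⁻ u : ℝ,
        ∑' E, ‖spectralProj (perturbed T P u) {E} (g n E)‖ₑ ^ 2 * w E) Filter.atTop :=
        lintegral_liminf_le fun n ↦ (hn n).1
    _ ≤ _ := Filter.liminf_le_of_frequently_le' (Filter.Frequently.of_forall fun n ↦ (hn n).2)

/-! ### Hölder-type inequalities for sums -/

/-- Hölder's inequality with exponents `2 - s` and `(2 - s) / (1 - s)`, applied to
`a p = (p ^ (s / (2 - s)) a) · p ^ ((2 - 2 s) / (2 - s))`. -/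
theorem tsum_mul_rpow_le {ι : Type*} (a p : ι → ℝ≥0∞) {s : ℝ} (hs0 : 0 < s) (hs1 : s < 1) :
    (∑' i, a i * p i) ^ (2 - s) ≤
      (∑' i, p i ^ s * a i ^ (2 - s)) * (∑' i, p i ^ 2) ^ (1 - s) := by
  have h2 : 0 < 2 - s := by linarith
  have h1 : 0 < 1 - s := by linarith
  rw [← ENNReal.le_rpow_inv_iff h2, ENNReal.tsum_eq_iSup_sum]
  refine iSup_le fun S ↦ ?_
  have hpq : (2 - s).HolderConjugate ((2 - s) / (1 - s)) := by
    rw [Real.holderConjugate_iff]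
    refine ⟨by linarith, ?_⟩
    field_simp
    ring
  have h := ENNReal.inner_le_Lp_mul_Lq S (fun i ↦ p i ^ (s / (2 - s)) * a i)
    (fun i ↦ p i ^ ((2 - 2 * s) / (2 - s))) hpq
  have e1 (i : ι) : p i ^ (s / (2 - s)) * a i * p i ^ ((2 - 2 * s) / (2 - s)) = a i * p i := by
    rw [mul_right_comm, ← ENNReal.rpow_add_of_nonneg _ _ (by positivity)
      (div_nonneg (by linarith) h2.le), ← add_div, show s + (2 - 2 * s) = 2 - s by ring,
      div_self h2.ne', ENNReal.rpow_one, mul_comm]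
  have e2 (i : ι) : (p i ^ (s / (2 - s)) * a i) ^ (2 - s) = p i ^ s * a i ^ (2 - s) := by
    rw [ENNReal.mul_rpow_of_nonneg _ _ h2.le, ← ENNReal.rpow_mul, div_mul_cancel₀ _ h2.ne']
  have e3 (i : ι) : (p i ^ ((2 - 2 * s) / (2 - s))) ^ ((2 - s) / (1 - s)) = p i ^ 2 := by
    rw [← ENNReal.rpow_mul, ← ENNReal.rpow_natCast]
    congr 1
    field_simp
    push_cast
    ring
  simp_rw [e1, e2, e3] at h
  refine h.trans ?_
  rw [ENNReal.mul_rpow_of_nonneg _ _ (by positivity), ← ENNReal.rpow_mul, one_div_div, one_div,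
    ← div_eq_mul_inv]
  gcongr <;> exact ENNReal.sum_le_tsum S

theorem rpow_tsum_le {ι : Type*} (a : ι → ℝ≥0∞) {t : ℝ} (ht0 : 0 < t) (ht1 : t ≤ 1) :
    (∑' i, a i) ^ t ≤ ∑' i, a i ^ t := by
  classical
  rw [← ENNReal.le_rpow_inv_iff ht0, ENNReal.tsum_eq_iSup_sum]
  refine iSup_le fun S ↦ ?_
  rw [ENNReal.le_rpow_inv_iff ht0]
  refine le_trans ?_ (ENNReal.sum_le_tsum S)
  induction S using Finset.induction_on with
  | empty => simp [ht0]
  | insert i S hi ih =>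
    rw [Finset.sum_insert hi, Finset.sum_insert hi]
    exact (ENNReal.rpow_add_le_add_rpow _ _ ht0.le ht1).trans (by gcongr)

theorem enorm_rpow_mul_enorm_rpow_le {V : Type*} [SeminormedAddCommGroup V] (x y : V)
    {s : ℝ} (hs0 : 0 < s) (hs1 : s < 1) :
    ‖x‖ₑ ^ s * ‖y‖ₑ ^ (2 - s) ≤
      ENNReal.ofReal (s / 2) * ‖x‖ₑ ^ 2 + ENNReal.ofReal (1 - s / 2) * ‖y‖ₑ ^ 2 := by
  have h := Real.geom_mean_le_arith_mean2_weighted (w₁ := s / 2) (w₂ := 1 - s / 2)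
    (p₁ := ‖x‖ ^ 2) (p₂ := ‖y‖ ^ 2) (by linarith) (by linarith) (by positivity) (by positivity)
    (by ring)
  rw [← Real.rpow_natCast, ← Real.rpow_natCast, ← Real.rpow_mul (norm_nonneg _),
    ← Real.rpow_mul (norm_nonneg _)] at h
  have h1 : 0 ≤ 1 - s / 2 := by linarith
  have h' := ENNReal.ofReal_le_ofReal h
  rw [ENNReal.ofReal_mul (by positivity), ENNReal.ofReal_add (by positivity) (by positivity),
    ENNReal.ofReal_mul (by positivity), ENNReal.ofReal_mul h1, Real.rpow_natCast,
    Real.rpow_natCast, ENNReal.ofReal_pow (norm_nonneg _), ENNReal.ofReal_pow (norm_nonneg _),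
    ← ENNReal.ofReal_rpow_of_nonneg (norm_nonneg _) (by norm_num; linarith),
    ← ENNReal.ofReal_rpow_of_nonneg (norm_nonneg _) (by norm_num; linarith),
    ofReal_norm, ofReal_norm] at h'
  convert! h' using 3 <;> push_cast <;> ring

/-- The `ℓ²` norm of the coefficients is at most their `ℓˢ` quasinorm. -/
theorem enorm_rpow_le_tsum [CompleteSpace H] {V : Submodule ℂ H} {ι : Type*}
    (b : HilbertBasis ι ℂ V) {y : H} (hy : y ∈ V) {s : ℝ} (hs0 : 0 < s) (hs1 : s < 1) :
    ‖y‖ₑ ^ s ≤ ∑' n, ‖inner ℂ (b n : H) y‖ₑ ^ s := by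
  have h := b.hasSum_inner_mul_inner ⟨y, hy⟩ ⟨y, hy⟩
  have h2 : HasSum (fun n ↦ ‖inner ℂ (b n : H) y‖ ^ 2) (‖y‖ ^ 2) := by
    have h3 := Complex.hasSum_re h
    rw [inner_self_eq_norm_sq_to_K] at h3
    convert! h3 using 1
    · ext n
      rw [← inner_conj_symm ⟨y, hy⟩ (b n), Complex.conj_mul', ← Complex.ofReal_pow,
        Complex.ofReal_re]
      rfl
    · simp [← Complex.ofReal_pow]
  have h4 : ‖y‖ₑ ^ 2 = ∑' n, ‖inner ℂ (b n : H) y‖ₑ ^ 2 := by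
    rw [← ofReal_norm, ← ENNReal.ofReal_pow (norm_nonneg _), ← h2.tsum_eq,
      ENNReal.ofReal_tsum_of_nonneg (fun _ ↦ by positivity) h2.summable]
    refine tsum_congr fun n ↦ ?_
    rw [ENNReal.ofReal_pow (norm_nonneg _), ofReal_norm]
  have e (x : ℝ≥0∞) : x ^ s = (x ^ 2) ^ (s / 2) := by
    rw [← ENNReal.rpow_natCast, ← ENNReal.rpow_mul]
    congr 1
    push_cast
    ring
  simp_rw [e]
  rw [h4]
  exact rpow_tsum_le _ (by linarith) (by linarith)

/-! ### Bounds for the eigenfunction correlator -/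

theorem stronglyMeasurable_resolvent [CompleteSpace H] [TopologicalSpace.SeparableSpace H]
    {T : H →ₗ.[ℂ] H} (hT : T.IsFormalAdjoint T) (hc : HasCompactResolvent T) (ψ : H) :
    StronglyMeasurable fun E : ℝ ↦ resolvent T E ψ := by
  classical
  borelize H
  have : SecondCountableTopology H := UniformSpace.secondCountable_of_separable H
  refine Measurable.stronglyMeasurable ?_
  set S : Set ℝ := {E : ℝ | (E : ℂ) ∈ resolventSet T} with hS
  have hSm : MeasurableSet S := by
    rw [← MeasurableSet.compl_iff]
    exact (countable_real_spectrum hT hc).measurableSet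
  have hI := mem_resolventSet_of_im_ne_zero hT hc (z := Complex.I) (by simp)
  have hcont : ContinuousOn (fun E : ℝ ↦ resolvent T E ψ) S := by
    have h : ContinuousOn (fun E : ℝ ↦ (resolvent T Complex.I *
        Ring.inverse (1 + (-((E : ℂ) - Complex.I)) • resolvent T Complex.I)) ψ) S := by
      intro E hE
      obtain ⟨w, hw⟩ := (resolvent_eq_mul_inverse hc hI hE).1
      have h1 : ContinuousAt Ring.inverse
          (1 + (-((E : ℂ) - Complex.I)) • resolvent T Complex.I) :=
        hw ▸ NormedRing.inverse_continuousAt w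
      have h2 : ContinuousAt (fun E : ℝ ↦ Ring.inverse
          (1 + (-((E : ℂ) - Complex.I)) • resolvent T Complex.I)) E :=
        ContinuousAt.comp (f := fun E : ℝ ↦ 1 + (-((E : ℂ) - Complex.I)) • resolvent T Complex.I)
          h1 (by fun_prop)
      exact ((continuousAt_const.mul h2).clm_apply continuousAt_const).continuousWithinAt
    exact h.congr fun E hE ↦ by simp only [(resolvent_eq_mul_inverse hc hI hE).2]
  have h := hcont.measurable_piecewise (continuousOn_const (c := (0 : H))) hSm
  convert! h using 1
  ext E
  by_cases hE : E ∈ S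
  · rw [Set.piecewise_eq_of_mem _ _ _ hE]
  · rw [Set.piecewise_eq_of_notMem _ _ _ hE, resolvent]
    have hE' : ¬∃ R : H →L[ℂ] H, IsResolventAt T E R := hE
    rw [dif_neg hE', zero_apply]

/-- Hölder's inequality for the correlator, after bounding its terms by `‖P_E φ‖ ‖P_E ψ‖`. -/
theorem correlator_rpow_le [CompleteSpace H] [TopologicalSpace.SeparableSpace H]
    {T : H →ₗ.[ℂ] H} (hT : T.IsFormalAdjoint T) (hc : HasCompactResolvent T) (φ ψ : H)
    {I : Set ℝ} (hI : MeasurableSet I) {s : ℝ} (hs0 : 0 < s) (hs1 : s < 1) :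
    correlator T φ ψ I ^ (2 - s) ≤
      (∑' E, I.indicator (fun E ↦ ‖spectralProj T {E} ψ‖ₑ ^ s *
        ‖spectralProj T {E} φ‖ₑ ^ (2 - s)) E) * ‖spectralProj T I ψ‖ₑ ^ (2 - 2 * s) := by
  have h1 : correlator T φ ψ I ≤ ∑' E, I.indicator (fun E ↦ ‖spectralProj T {E} φ‖ₑ) E *
      I.indicator (fun E ↦ ‖spectralProj T {E} ψ‖ₑ) E := by
    rw [correlator_eq_tsum hT hc]
    refine ENNReal.tsum_le_tsum fun E ↦ ?_
    by_cases hE : E ∈ I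
    · simp only [Set.indicator_of_mem hE]
      rw [← inner_spectralProj_spectralProj hT hc, ← ofReal_norm, ← ofReal_norm, ← ofReal_norm,
        ← ENNReal.ofReal_mul (norm_nonneg _)]
      exact ENNReal.ofReal_le_ofReal (norm_inner_le_norm _ _)
    · simp [hE]
  have h2 := (ENNReal.rpow_le_rpow h1 (show 0 ≤ 2 - s by linarith)).trans
    (tsum_mul_rpow_le _ _ hs0 hs1)
  refine h2.trans (mul_le_mul' (ENNReal.tsum_le_tsum fun E ↦ ?_) (le_of_eq ?_))
  · by_cases hE : E ∈ I
    · simp only [Set.indicator_of_mem hE]; exact le_rfl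
    · simp [hE, hs0]
  · have h3 : ∑' E, I.indicator (fun E ↦ ‖spectralProj T {E} ψ‖ₑ) E ^ 2 =
        ‖spectralProj T I ψ‖ₑ ^ 2 := by
      rw [← specMeasure_eq_enorm_spectralProj_sq hT hc ψ hI, specMeasure_apply T ψ hI]
      refine tsum_congr fun E ↦ ?_
      by_cases hE : E ∈ I <;> simp [hE]
    rw [h3, ← ENNReal.rpow_natCast, ← ENNReal.rpow_mul]
    congr 1
    push_cast
    ring

theorem lintegral_enorm_resolvent_rpow_le_tsum [CompleteSpace H]
    [TopologicalSpace.SeparableSpace H] {T : H →ₗ.[ℂ] H} (hT : T.IsFormalAdjoint T)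
    (hc : HasCompactResolvent T) {P : H →L[ℂ] H} (hP : IsStarProjection P) {ι : Type*}
    (b : HilbertBasis ι ℂ (LinearMap.range (P : H →ₗ[ℂ] H))) (I : Set ℝ) (ψ : H) {s : ℝ}
    (hs0 : 0 < s) (hs1 : s < 1) :
    ∫⁻ E in I, ‖P (resolvent T E ψ)‖ₑ ^ s ≤
      ∑' n, ∫⁻ E in I, ‖inner ℂ (b n : H) (resolvent T E ψ)‖ₑ ^ s := by
  have hb : Orthonormal ℂ fun n ↦ (b n : H) :=
    b.orthonormal.comp_linearIsometry (LinearMap.range (P : H →ₗ[ℂ] H)).subtypeₗᵢ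
  have := countable_of_orthonormal hb
  rw [← lintegral_tsum fun n ↦ ?_]
  · refine lintegral_mono fun E ↦ ?_
    refine (enorm_rpow_le_tsum b (y := P (resolvent T E ψ)) ⟨_, rfl⟩ hs0 hs1).trans_eq
      (tsum_congr fun n ↦ ?_)
    have h1 := hP.isSelfAdjoint.isSymmetric (b n : H) (resolvent T E ψ)
    have h2 : P (b n : H) = b n := by
      obtain ⟨y, hy⟩ := (b n).2
      rw [← hy]
      exact DFunLike.congr_fun hP.isIdempotentElem y
    simp only [ContinuousLinearMap.coe_coe, h2] at h1
    rw [h1]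
  · have h1 := (innerSL ℂ (b n : H)).continuous.comp_stronglyMeasurable
      (stronglyMeasurable_resolvent hT hc ψ)
    exact (h1.enorm.pow_const s).aemeasurable

/-- The vector `P (T - E)⁻¹ ψ` normalised to length one, or `0` if it vanishes. -/
noncomputable def resolventDirection (T : H →ₗ.[ℂ] H) (P : H →L[ℂ] H) (ψ : H) (E : ℝ) : H :=
  ((‖P (resolvent T E ψ)‖ : ℂ)⁻¹) • P (resolvent T E ψ)

/-- An eigenvector of `T + u P` at a point `E` of the resolvent set of `T` satisfies
`Ψ = -u (T - E)⁻¹ P Ψ`, which bounds the eigenprojection of `ψ` by that of `P (T - E)⁻¹ ψ`. -/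
theorem norm_spectralProj_perturbed_le [CompleteSpace H]
    {T : H →ₗ.[ℂ] H} (hT : T.IsFormalAdjoint T) (hc : HasCompactResolvent T) {P : H →L[ℂ] H}
    (hP : IsSelfAdjoint P) {E : ℝ} (hE : (E : ℂ) ∈ resolventSet T) (u : ℝ) (ψ : H) :
    ‖spectralProj (perturbed T P u) {E} ψ‖ ≤ |u| * ‖P (resolvent T E ψ)‖ *
      ‖spectralProj (perturbed T P u) {E} (resolventDirection T P ψ E)‖ := by
  have hTu := isFormalAdjoint_perturbed hT hP u
  have hcu := hasCompactResolvent_perturbed hT hc hP u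
  have hR := isResolventAt_resolvent hE
  set R := resolvent T E
  set y := P (R ψ) with hy
  have hmem := spectralProj_singleton_mem hTu hcu E ψ
  set Ψ := spectralProj (perturbed T P u) {E} ψ with hΨ
  obtain ⟨hd, he⟩ := mem_eigenspace_iff.mp hmem
  have hd' : Ψ ∈ T.domain := hd
  have he' : (u : ℂ) • P Ψ + T ⟨Ψ, hd'⟩ = (E : ℂ) • Ψ := he
  have hΨR : Ψ = -(u : ℂ) • R (P Ψ) := by
    have h1 := hR.2 ⟨Ψ, hd'⟩
    rw [show T ⟨Ψ, hd'⟩ - (E : ℂ) • Ψ = -(u : ℂ) • P Ψ by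
      linear_combination (norm := module) he', map_smul] at h1
    exact h1.symm
  have hsq : ((‖Ψ‖ : ℂ)) ^ 2 = -(u : ℂ) * inner ℂ Ψ y := by
    calc ((‖Ψ‖ : ℂ)) ^ 2 = inner ℂ Ψ Ψ := by
          rw [inner_self_eq_norm_sq_to_K]; rfl
      _ = inner ℂ Ψ ψ := inner_spectralProj_of_mem hmem ψ
      _ = -(u : ℂ) * inner ℂ (R (P Ψ)) ψ := by
          conv_lhs => rw [hΨR]
          rw [inner_smul_left]
          simp
      _ = -(u : ℂ) * inner ℂ Ψ y := by
          rw [inner_resolvent_left hT hR]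
          congr 1
          exact hP.isSymmetric Ψ (R ψ)
  have hyd : y = (‖y‖ : ℂ) • resolventDirection T P ψ E := by
    rw [resolventDirection, ← hy]
    rcases eq_or_ne y 0 with h0 | h0
    · simp [h0]
    · rw [smul_inv_smul₀ (by simpa using h0)]
  have hle : ‖Ψ‖ ^ 2 ≤ |u| * ‖y‖ *
      ‖spectralProj (perturbed T P u) {E} (resolventDirection T P ψ E)‖ * ‖Ψ‖ := by
    have h1 := congrArg norm hsq
    rw [hyd, inner_smul_right, ← inner_spectralProj_of_mem hmem] at h1
    simp only [norm_pow, norm_mul, norm_neg, Complex.norm_real, Real.norm_eq_abs, abs_norm] at h1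
    rw [h1]
    have h2 := norm_inner_le_norm (𝕜 := ℂ) Ψ
      (spectralProj (perturbed T P u) {E} (resolventDirection T P ψ E))
    calc _ ≤ |u| * (‖y‖ * (‖Ψ‖ *
          ‖spectralProj (perturbed T P u) {E} (resolventDirection T P ψ E)‖)) := by gcongr
      _ = _ := by ring
  rcases (norm_nonneg Ψ).eq_or_lt with h0 | h0
  · rw [← h0]; positivity
  · rw [sq] at hle
    exact le_of_mul_le_mul_right hle h0

/-- The mixed powers of the two eigenprojections are bounded by squares, to which spectral averaging
applies. -/
theorem enorm_spectralProj_rpow_le [CompleteSpace H]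
    {T : H →ₗ.[ℂ] H} (hT : T.IsFormalAdjoint T) (hc : HasCompactResolvent T) {P : H →L[ℂ] H}
    (hP : IsSelfAdjoint P) {E : ℝ} (hE : (E : ℂ) ∈ resolventSet T) (u : ℝ) (φ ψ : H)
    {s : ℝ} (hs0 : 0 < s) (hs1 : s < 1) :
    ‖spectralProj (perturbed T P u) {E} ψ‖ₑ ^ s *
        ‖spectralProj (perturbed T P u) {E} φ‖ₑ ^ (2 - s) ≤
      ENNReal.ofReal (|u| ^ s) *
        (ENNReal.ofReal (s / 2) *
          (‖spectralProj (perturbed T P u) {E} (resolventDirection T P ψ E)‖ₑ ^ 2 *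
            ‖P (resolvent T E ψ)‖ₑ ^ s) +
          ENNReal.ofReal (1 - s / 2) *
          (‖spectralProj (perturbed T P u) {E} φ‖ₑ ^ 2 * ‖P (resolvent T E ψ)‖ₑ ^ s)) := by
  have h := ENNReal.ofReal_le_ofReal (norm_spectralProj_perturbed_le hT hc hP hE u ψ)
  rw [ENNReal.ofReal_mul (by positivity), ENNReal.ofReal_mul (by positivity), ofReal_norm,
    ofReal_norm, ofReal_norm] at h
  have h1 := ENNReal.rpow_le_rpow h hs0.le
  rw [ENNReal.mul_rpow_of_nonneg _ _ hs0.le, ENNReal.mul_rpow_of_nonneg _ _ hs0.le,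
    ENNReal.ofReal_rpow_of_nonneg (abs_nonneg u) hs0.le] at h1
  have h2 := enorm_rpow_mul_enorm_rpow_le
    (spectralProj (perturbed T P u) {E} (resolventDirection T P ψ E))
    (spectralProj (perturbed T P u) {E} φ) hs0 hs1
  calc _ ≤ ENNReal.ofReal (|u| ^ s) * ‖P (resolvent T E ψ)‖ₑ ^ s *
        ‖spectralProj (perturbed T P u) {E} (resolventDirection T P ψ E)‖ₑ ^ s *
        ‖spectralProj (perturbed T P u) {E} φ‖ₑ ^ (2 - s) := by gcongr
    _ = ENNReal.ofReal (|u| ^ s) * ‖P (resolvent T E ψ)‖ₑ ^ s *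
        (‖spectralProj (perturbed T P u) {E} (resolventDirection T P ψ E)‖ₑ ^ s *
        ‖spectralProj (perturbed T P u) {E} φ‖ₑ ^ (2 - s)) := by ring
    _ ≤ _ := mul_le_mul_right h2 _
    _ = _ := by ring

/-- For almost every coupling, `φ` in the range of `P` has no mass on the spectrum of `T`. -/
theorem ae_forall_spectralProj_eq_zero [CompleteSpace H] [TopologicalSpace.SeparableSpace H]
    {T : H →ₗ.[ℂ] H} (hT : T.IsFormalAdjoint T) (hc : HasCompactResolvent T) {P : H →L[ℂ] H}
    (hP : IsStarProjection P) {φ : H} (hφ : P φ = φ) (hφ1 : ‖φ‖ ≤ 1) :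
    ∀ᵐ u : ℝ, ∀ E : ℝ, (E : ℂ) ∉ resolventSet T → spectralProj (perturbed T P u) {E} φ = 0 := by
  set N : Set ℝ := {E : ℝ | (E : ℂ) ∉ resolventSet T} with hN
  have hNc : N.Countable := countable_real_spectrum hT hc
  have h := lintegral_lintegral_specMeasure_le hT hc hP hφ hφ1
    (measurable_one.indicator hNc.measurableSet)
  simp_rw [lintegral_indicator_one hNc.measurableSet] at h
  have hm : Measurable fun u : ℝ ↦ specMeasure (perturbed T P u) φ N :=
    (Measure.measurable_coe hNc.measurableSet).comp
      (measurable_specMeasure_perturbed hT hc hP.isSelfAdjoint φ)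
  rw [hNc.measure_zero, nonpos_iff_eq_zero, lintegral_eq_zero_iff hm] at h
  filter_upwards [h] with u hu E hE
  have h1 : specMeasure (perturbed T P u) φ {E} = 0 :=
    measure_mono_null (Set.singleton_subset_iff.mpr hE) hu
  rw [specMeasure_singleton] at h1
  simpa using h1

/-- The averaging bound with the full norm of `P (T - E)⁻¹ ψ` on the right-hand side. -/
theorem lintegral_correlator_le [CompleteSpace H] [TopologicalSpace.SeparableSpace H]
    {T : H →ₗ.[ℂ] H} (hT : T.IsFormalAdjoint T) (hc : HasCompactResolvent T) {P : H →L[ℂ] H}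
    (hP : IsStarProjection P) {φ : H} (hφ : P φ = φ) (hφ1 : ‖φ‖ ≤ 1) (ψ : H)
    {I : Set ℝ} (hI : MeasurableSet I) {s : ℝ} (hs0 : 0 < s) (hs1 : s < 1) :
    ∫⁻ u : ℝ, correlator (perturbed T P u) φ ψ I ^ (2 - s) /
        ‖spectralProj (perturbed T P u) I ψ‖ₑ ^ (2 - 2 * s) / ENNReal.ofReal (|u| ^ s) ≤
      ∫⁻ E in I, ‖P (resolvent T E ψ)‖ₑ ^ s := by
  have hTu (u : ℝ) := isFormalAdjoint_perturbed hT hP.isSelfAdjoint u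
  have hcu (u : ℝ) := hasCompactResolvent_perturbed hT hc hP.isSelfAdjoint u
  have hy : StronglyMeasurable fun E : ℝ ↦ P (resolvent T E ψ) :=
    P.continuous.comp_stronglyMeasurable (stronglyMeasurable_resolvent hT hc ψ)
  have he : StronglyMeasurable (resolventDirection T P ψ) :=
    (Complex.measurable_ofReal.comp hy.norm.measurable).inv.stronglyMeasurable.smul hy
  have hPP (x : H) : P (P x) = P x := DFunLike.congr_fun hP.isIdempotentElem x
  have heP (E : ℝ) : P (resolventDirection T P ψ E) = resolventDirection T P ψ E ∧
      ‖resolventDirection T P ψ E‖ ≤ 1 := by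
    refine ⟨by rw [resolventDirection, map_smul, hPP], ?_⟩
    rw [resolventDirection, norm_smul]
    simp only [norm_inv, Complex.norm_real, norm_norm]
    exact inv_mul_le_one
  set w : ℝ → ℝ≥0∞ := I.indicator fun E ↦ ‖P (resolvent T E ψ)‖ₑ ^ s with hw
  have hwm : Measurable w := (hy.enorm.pow_const s).indicator hI
  have hwt (E : ℝ) : w E ≠ ∞ := by
    by_cases hE : E ∈ I
    · rw [hw, Set.indicator_of_mem hE]
      exact ENNReal.rpow_ne_top_of_nonneg hs0.le enorm_ne_top
    · simp [hw, hE]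
  have hpoint : ∀ᵐ u : ℝ, correlator (perturbed T P u) φ ψ I ^ (2 - s) /
        ‖spectralProj (perturbed T P u) I ψ‖ₑ ^ (2 - 2 * s) / ENNReal.ofReal (|u| ^ s) ≤
      ENNReal.ofReal (s / 2) * (∑' E, ‖spectralProj (perturbed T P u) {E}
          (resolventDirection T P ψ E)‖ₑ ^ 2 * w E) +
        ENNReal.ofReal (1 - s / 2) * ∫⁻ E, w E ∂specMeasure (perturbed T P u) φ := by
    have hne : ∀ᵐ u : ℝ, u ≠ 0 := by simp [ae_iff]
    filter_upwards [ae_forall_spectralProj_eq_zero hT hc hP hφ hφ1, hne] with u hu hu0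
    refine ENNReal.div_le_of_le_mul' (ENNReal.div_le_of_le_mul
      ((correlator_rpow_le (hTu u) (hcu u) φ ψ hI hs0 hs1).trans ?_))
    gcongr
    rw [lintegral_specMeasure, ← ENNReal.tsum_mul_left, ← ENNReal.tsum_mul_left,
      ← ENNReal.tsum_add, ← ENNReal.tsum_mul_left]
    refine ENNReal.tsum_le_tsum fun E ↦ ?_
    by_cases hE : E ∈ I
    · simp only [hw, Set.indicator_of_mem hE]
      by_cases hEr : (E : ℂ) ∈ resolventSet T
      · exact enorm_spectralProj_rpow_le hT hc hP.isSelfAdjoint hEr u φ ψ hs0 hs1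
      · rw [hu E hEr, enorm_zero, ENNReal.zero_rpow_of_pos (by linarith), mul_zero]
        exact zero_le
    · simp [hE]
  have hm2 : Measurable fun u : ℝ ↦ ∫⁻ E, w E ∂specMeasure (perturbed T P u) φ :=
    (Measure.measurable_lintegral hwm).comp
      (measurable_specMeasure_perturbed hT hc hP.isSelfAdjoint φ)
  refine (lintegral_mono_ae hpoint).trans ?_
  rw [lintegral_add_right _ (hm2.const_mul _), lintegral_const_mul' _ _ ENNReal.ofReal_ne_top,
    lintegral_const_mul' _ _ ENNReal.ofReal_ne_top, ← lintegral_indicator hI, ← hw]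
  calc _ ≤ ENNReal.ofReal (s / 2) * (∫⁻ E, w E) + ENNReal.ofReal (1 - s / 2) * ∫⁻ E, w E := by
        gcongr ?_ * ?_ + ?_ * ?_
        · exact le_rfl
        · exact lintegral_tsum_le hT hc hP hwm hwt he heP
        · exact le_rfl
        · exact lintegral_lintegral_specMeasure_le hT hc hP hφ hφ1 hwm
    _ = ∫⁻ E, w E := by
        rw [← add_mul, ← ENNReal.ofReal_add (by linarith) (by linarith)]
        simp

end AveragingBound

theorem theoremD1 {H : Type*} [NormedAddCommGroup H] [InnerProductSpace ℂ H] [CompleteSpace H]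
    [TopologicalSpace.SeparableSpace H]
    (H₀ : H →ₗ.[ℂ] H) (hH₀ : IsSelfAdjoint H₀) (hcomp : AveragingBound.HasCompactResolvent H₀)
    (P : H →L[ℂ] H) (hP : IsStarProjection P)
    {ι : Type*} (b : HilbertBasis ι ℂ (LinearMap.range (P : H →ₗ[ℂ] H)))
    (s : ℝ) (hs0 : 0 < s) (hs1 : s < 1)
    (I : Set ℝ) (hI : I.OrdConnected)
    (φ : H) (hφ : φ ∈ LinearMap.range (P : H →ₗ[ℂ] H)) (hφ1 : ‖φ‖ = 1) (ψ : H) (v : ℝ) :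
    -- the integrands below are measurable functions of `u`
    AEMeasurable
        (fun u : ℝ => AveragingBound.correlator (AveragingBound.perturbed H₀ P (u + v)) φ ψ I) ∧
      AEMeasurable
        (fun u : ℝ => ‖AveragingBound.spectralProj (AveragingBound.perturbed H₀ P (u + v)) I ψ‖ₑ) ∧
      -- the bound with the norm of `P_I(H_{u+v}) ψ` under the integral sign
      ∫⁻ u : ℝ,
          AveragingBound.correlator (AveragingBound.perturbed H₀ P (u + v)) φ ψ I ^ (2 - s) /
            ‖AveragingBound.spectralProj (AveragingBound.perturbed H₀ P (u + v)) I ψ‖ₑ ^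
              (2 - 2 * s) /
            ENNReal.ofReal (|u| ^ s) ≤
        ∑' n : ι, ∫⁻ E in I,
          ‖inner ℂ (b n : H)
            (AveragingBound.resolvent (AveragingBound.perturbed H₀ P v) (E : ℂ) ψ)‖ₑ ^ s ∧
      -- the bound with the supremum over `u` of these norms as a prefactor
      ∫⁻ u : ℝ,
          AveragingBound.correlator (AveragingBound.perturbed H₀ P (u + v)) φ ψ I ^ (2 - s) /
            ENNReal.ofReal (|u| ^ s) ≤
        (⨆ u : ℝ,
            ‖AveragingBound.spectralProj (AveragingBound.perturbed H₀ P (u + v)) I ψ‖ₑ) ^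
            (2 - 2 * s) *
          ∑' n : ι, ∫⁻ E in I,
            ‖inner ℂ (b n : H)
              (AveragingBound.resolvent (AveragingBound.perturbed H₀ P v) (E : ℂ) ψ)‖ₑ ^ s := by
  have hA := AveragingBound.isFormalAdjoint_perturbed
    (AveragingBound.isFormalAdjoint_self_of_isSelfAdjoint hH₀) hP.isSelfAdjoint v
  have hcA := AveragingBound.hasCompactResolvent_perturbed
    (AveragingBound.isFormalAdjoint_self_of_isSelfAdjoint hH₀) hcomp hP.isSelfAdjoint v
  simp_rw [fun u ↦ AveragingBound.perturbed_add H₀ P u v]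
  set A := AveragingBound.perturbed H₀ P v
  have hTu (u : ℝ) := AveragingBound.isFormalAdjoint_perturbed hA hP.isSelfAdjoint u
  have hcu (u : ℝ) := AveragingBound.hasCompactResolvent_perturbed hA hcA hP.isSelfAdjoint u
  have hIm := hI.measurableSet
  have hPr {x : H} (hx : x ∈ LinearMap.range (P : H →ₗ[ℂ] H)) : P x = x := by
    obtain ⟨y, rfl⟩ := hx
    exact DFunLike.congr_fun hP.isIdempotentElem y
  have hbound := (AveragingBound.lintegral_correlator_le hA hcA hP (hPr hφ) hφ1.le ψ hIm
    hs0 hs1).trans (AveragingBound.lintegral_enorm_resolvent_rpow_le_tsum hA hcA hP b I ψ hs0 hs1)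
  refine ⟨(AveragingBound.measurable_correlator_perturbed hA hcA hP.isSelfAdjoint φ ψ
      hIm).aemeasurable,
    (AveragingBound.measurable_enorm_spectralProj_perturbed hA hcA hP.isSelfAdjoint ψ
      hIm).aemeasurable, hbound, ?_⟩
  set M : ℝ≥0∞ := ⨆ u : ℝ, ‖AveragingBound.spectralProj (AveragingBound.perturbed A P u) I ψ‖ₑ
  have hM : M ≠ ∞ := by
    refine ne_top_of_le_ne_top (enorm_ne_top (x := ψ)) (iSup_le fun u ↦ ?_)
    rw [← ofReal_norm, ← ofReal_norm]
    exact ENNReal.ofReal_le_ofReal (Submodule.norm_starProjection_apply_le _ ψ)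
  have hs2 : 0 < 2 - 2 * s := by linarith
  refine le_trans ?_ (mul_le_mul_right hbound _)
  rw [← lintegral_const_mul' _ _ (ENNReal.rpow_ne_top_of_nonneg hs2.le hM)]
  refine lintegral_mono fun u ↦ ?_
  rw [← mul_div_assoc]
  gcongr
  have hQ := AveragingBound.correlator_rpow_le (hTu u) (hcu u) φ ψ hIm hs0 hs1
  set n := ‖AveragingBound.spectralProj (AveragingBound.perturbed A P u) I ψ‖ₑ with hn
  have hnM : n ≤ M := le_iSup
    (fun u ↦ ‖AveragingBound.spectralProj (AveragingBound.perturbed A P u) I ψ‖ₑ) u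
  rcases eq_or_ne n 0 with h0 | h0
  -- if the projection vanishes then so does the correlator
  · rw [h0, ENNReal.zero_rpow_of_pos hs2, mul_zero] at hQ
    exact hQ.trans zero_le
  · calc _ = n ^ (2 - 2 * s) * (AveragingBound.correlator (AveragingBound.perturbed A P u) φ ψ I ^
          (2 - s) / n ^ (2 - 2 * s)) := (ENNReal.mul_div_cancel
            (ENNReal.rpow_pos (pos_iff_ne_zero.mpr h0) enorm_ne_top).ne'
            (ENNReal.rpow_ne_top_of_nonneg hs2.le enorm_ne_top)).symm
      _ ≤ _ := by gcongr
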